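/- Let $\mathbb{K}$ be a field of characteristic zero. Let $\mathrm{dTL}$ be the dotted Temperley--Lieb category: the $\mathbb{Z}$-graded $\mathbb{K}$-linear pivotal category freely generated by one symmetrically self-dual object $c$ and one endomorphism $x$ of $c$ of degree $2$ (drawn as a dot), modulo the monoidal ideal generated by the following three relations: a circle equals $2$; two dots on a strand are zero; and, for two adjacent vertical strands, the sum of a dot on the left strand and a dot on the right strand equals the sum of the two diagrams consisting of a cap below a cup with one dot on the cap, respectively on the cup. Thus its objects are the tensor powers $c^n$, $n\in\mathbb{N}$, and $\mathrm{Hom}(c^m,c^n)$ is spanned by dotted planar tangles from $m$ to $n$ points up to planar isotopy, modulo these relations; the degree of a tangle is twice its number of dots. The symmetric group $\mathfrak{S}_n$ acts on $c^n$, the transposition of the adjacent strands $i,i+1$ acting as $\mathrm{id}$ minus the (undotted) cap-cup on these strands. Let $P_n=\frac{1}{n!}\sum_{w\in\mathfrak{S}_n}w\in\mathrm{End}^0(c^n)$ be the symmetrizing idempotent (Jones--Wenzl projector), also regarded as an object of the graded Karoubi envelope $\mathrm{Kar}(\mathrm{dTL})$. Let $U_n\colon P_n\to P_{n+2}$ be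 the degree $2$ morphism $P_{n+2}\circ(\mathrm{id}_{c^n}\otimes \text{dotted cup})\circ P_n$. Let $\overline{\mathrm{dTL}}=\mathrm{Ind}(\mathrm{Mat}(\mathrm{Kar}(\mathrm{dTL})))$, where $\mathrm{Mat}$ formally adjoins grading shifts $q^k$ and finite direct sums and $\mathrm{Ind}$ is the ind-completion, in which the graded morphism space between filtered diagrams $\alpha,\beta$ of degree zero morphisms is $\lim_i\mathrm{colim}_j\mathrm{Hom}(\alpha(i),\beta(j))$, computed in graded vector spaces, that is, degree by degree. For $i\geq 0$ the Kirby object $\omega_i\in\overline{\mathrm{dTL}}$ is the directed system $$q^{-i}P_i\xrightarrow{U_i}q^{-i-2}P_{i+2}\xrightarrow{U_{i+2}}q^{-i-4}P_{i+4}\to\cdots,$$ and $\omega_i:=\omega_{|i|}$ for $i<0$. Then for every $i\in\mathbb{Z}$ there is an isomorphism of graded $\mathbb{K}$-algebras $$\mathrm{End}_{\overline{\mathrm{dTL}}}(\omega_i)\cong\mathbb{K}[z],\qquad \deg z=2,$$ where $\mathrm{End}_{\overline{\mathrm{dTL}}}(\omega_i)=\bigoplus_{d\in\mathbb{Z}}\mathrm{End}^d_{\overline{\mathrm{dTL}}}(\omega_i)$.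 -/

import Mathlib

open CategoryTheory DirectSum Polynomial

universe u v w

namespace KirbyColor

noncomputable section

/-! ### Graded linear categories -/

/-- A `ℤ`-graded `K`-linear category: a category enriched in `ℤ`-graded `K`-vector spaces, where a
graded vector space is a `ℤ`-indexed family of vector spaces. `Hom X Y d` is the space of morphisms
`X ⟶ Y` of degree `d`, and `comp h f g` is the composite "first `f`, then `g`"; its degree is
allowed to be any `k` that comes with a proof `h` that `k` is the sum of the degrees. -/
structure GrCat (K : Type u) [Field K] where
  Obj : Type w
  Hom : Obj → Obj → ℤ → Type v
  [homGroup : ∀ X Y d, AddCommGroup (Hom X Y d)]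
  [homModule : ∀ X Y d, Module K (Hom X Y d)]
  id : ∀ X : Obj, Hom X X 0
  comp : ∀ {X Y Z : Obj} {i j k : ℤ}, i + j = k →
    (Hom X Y i →ₗ[K] Hom Y Z j →ₗ[K] Hom X Z k)
  id_comp : ∀ {X Y : Obj} {d : ℤ} (h : 0 + d = d) (f : Hom X Y d), comp h (id X) f = f
  comp_id : ∀ {X Y : Obj} {d : ℤ} (h : d + 0 = d) (f : Hom X Y d), comp h f (id Y) = f
  assoc : ∀ {W X Y Z : Obj} {i j k ij jk ijk : ℤ} (h₁ : i + j = ij) (h₂ : ij + k = ijk)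
    (h₃ : j + k = jk) (h₄ : i + jk = ijk) (f : Hom W X i) (g : Hom X Y j) (l : Hom Y Z k),
    comp h₂ (comp h₁ f g) l = comp h₄ f (comp h₃ g l)

namespace GrCat

variable {K : Type u} [Field K] (C : GrCat.{u, v, w} K)

instance (X Y : C.Obj) (d : ℤ) : AddCommGroup (C.Hom X Y d) := C.homGroup X Y d

instance (X Y : C.Obj) (d : ℤ) : Module K (C.Hom X Y d) := C.homModule X Y d

/-- The degree zero subcategory. -/
def Zero : Type w := C.Obj

instance : Category.{v, w} C.Zero where
  Hom X Y := C.Hom X Y 0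
  id X := C.id X
  comp f g := C.comp (zero_add 0) f g
  id_comp f := C.id_comp _ f
  comp_id f := C.comp_id _ f
  assoc f g h := C.assoc _ _ _ _ f g h

/-! #### Endomorphisms -/

/-- Degree zero endomorphisms. -/
def End₀ (X : C.Obj) : Type v := C.Hom X X 0

instance (X : C.Obj) : AddCommGroup (C.End₀ X) := C.homGroup X X 0

instance (X : C.Obj) : Module K (C.End₀ X) := C.homModule X X 0

/-- Degree zero endomorphisms form a ring, with `f * g = f ∘ g`. -/
instance (X : C.Obj) : Ring (C.End₀ X) :=
  { (inferInstance : AddCommGroup (C.End₀ X)) with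
    mul := fun f g => C.comp (zero_add 0) g f
    one := C.id X
    left_distrib := fun f g h => LinearMap.map_add₂ (C.comp (zero_add 0)) g h f
    right_distrib := fun f g h => (C.comp (zero_add 0) h).map_add f g
    zero_mul := fun f => (C.comp (zero_add 0) f).map_zero
    mul_zero := fun f => LinearMap.map_zero₂ (C.comp (zero_add 0)) f
    mul_assoc := fun f g h => (C.assoc _ _ _ _ h g f).symm
    one_mul := fun f => C.comp_id _ f
    mul_one := fun f => C.id_comp _ f }

instance (X : C.Obj) : Algebra K (C.End₀ X) :=
  Algebra.ofModule (fun r f g => LinearMap.map_smul (C.comp (zero_add 0) g) r f)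
    (fun r f g => LinearMap.map_smul₂ (C.comp (zero_add 0)) r g f)

/-- The family of endomorphisms of `X` of all degrees. -/
abbrev GrEnd (X : C.Obj) : ℤ → Type v := fun d => C.Hom X X d

/-- The degree of a composite may be replaced by an equal one. -/
theorem mk_comp {X : C.Obj} {Y : C.Obj} {i j k k' : ℤ} (h : i + j = k) (h' : i + j = k')
    (f : C.Hom X Y i) (g : C.Hom Y X j) :
    GradedMonoid.mk (A := C.GrEnd X) k (C.comp h f g) = GradedMonoid.mk k' (C.comp h' f g) := by
  subst h; subst h'; rfl

instance (X : C.Obj) : GradedMonoid.GOne (C.GrEnd X) := ⟨C.id X⟩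

/-- The multiplication of endomorphisms is composition, `f * g = f ∘ g`. -/
instance (X : C.Obj) : GradedMonoid.GMul (C.GrEnd X) := ⟨fun {i j} f g => C.comp (add_comm j i) g f⟩

instance (X : C.Obj) : GradedMonoid.GMonoid (C.GrEnd X) where
  one_mul := by
    rintro ⟨d, f⟩
    refine (C.mk_comp (add_comm d 0) (add_zero d) f (C.id X)).trans ?_
    exact congrArg (GradedMonoid.mk d) (C.comp_id _ f)
  mul_one := by
    rintro ⟨d, f⟩
    refine (C.mk_comp (add_comm 0 d) (zero_add d) (C.id X) f).trans ?_
    exact congrArg (GradedMonoid.mk d) (C.id_comp _ f)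
  mul_assoc := by
    rintro ⟨i, f⟩ ⟨j, g⟩ ⟨k, h⟩
    refine (C.mk_comp (add_comm k (i + j)) (k' := i + (j + k)) (by ring) h
      (C.comp (add_comm j i) g f)).trans ?_
    rw [← C.assoc (add_comm k j) (add_comm (j + k) i) (add_comm j i) (by ring) h g f]
    rfl

instance (X : C.Obj) : DirectSum.GRing (C.GrEnd X) where
  __ := (inferInstance : GradedMonoid.GMonoid (C.GrEnd X))
  mul_zero {i j} f := LinearMap.map_zero₂ (C.comp (add_comm j i)) f
  zero_mul {i j} f := (C.comp (add_comm j i) f).map_zero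
  mul_add {i j} f g h := LinearMap.map_add₂ (C.comp (add_comm j i)) g h f
  add_mul {i j} f g h := (C.comp (add_comm j i) h).map_add f g
  natCast n := n • C.id X
  natCast_zero := zero_smul ℕ (C.id X)
  natCast_succ n := succ_nsmul (C.id X) n
  intCast n := n • C.id X
  intCast_ofNat n := natCast_zsmul (C.id X) n
  intCast_negSucc_ofNat n := negSucc_zsmul (C.id X) n

/-- The graded endomorphism algebra of `X`, a graded `K`-algebra. -/
instance (X : C.Obj) : DirectSum.GAlgebra K (C.GrEnd X) where
  toFun := (LinearMap.toSpanSingleton K (C.Hom X X 0) (C.id X)).toAddMonoidHom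
  map_one := one_smul K (C.id X)
  map_mul r s := by
    refine Eq.trans ?_ (C.mk_comp (k := 0) (add_zero 0) (add_comm 0 0) (s • C.id X) (r • C.id X))
    rw [LinearMap.map_smul₂, map_smul, C.id_comp, smul_smul, mul_comm]
    rfl
  commutes := by
    rintro r ⟨d, f⟩
    refine (C.mk_comp (add_comm d 0) (add_zero d) f (r • C.id X)).trans (Eq.trans ?_
      (C.mk_comp (zero_add d) (add_comm 0 d) (r • C.id X) f))
    refine congrArg (GradedMonoid.mk d) ?_
    rw [LinearMap.map_smul₂, map_smul, C.id_comp, C.comp_id]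
  smul_def := by
    rintro r ⟨d, f⟩
    refine Eq.trans ?_ (C.mk_comp (add_zero d) (add_comm d 0) f (r • C.id X))
    refine congrArg (GradedMonoid.mk d) ?_
    rw [map_smul, C.comp_id]

end GrCat

/-! ### Karoubi envelope, additive completion, ind-completion -/

namespace GrCat

variable {K : Type u} [Field K] (C : GrCat.{u, v, w} K)

/-- An object of the Karoubi envelope: an object with a degree zero idempotent endomorphism. -/
structure KarObj where
  obj : C.Obj
  e : C.Hom obj obj 0
  idem : C.comp (add_zero 0) e e = e

/-- The morphisms `f` of degree `d` with `f = e' ∘ f ∘ e`. -/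
def karHom (P Q : C.KarObj) (d : ℤ) : Submodule K (C.Hom P.obj Q.obj d) where
  carrier := {f | f = C.comp (add_zero d) (C.comp (zero_add d) P.e f) Q.e}
  add_mem' {f g} hf hg := by
    simp only [Set.mem_ofPred_eq, map_add, LinearMap.add_apply] at *
    rw [← hf, ← hg]
  zero_mem' := by simp
  smul_mem' r f hf := by
    simp only [Set.mem_ofPred_eq, map_smul, LinearMap.smul_apply] at *
    rw [← hf]

variable {C} in
theorem karHom_left {P Q : C.KarObj} {d : ℤ} (f : C.karHom P Q d) (h : 0 + d = d) :
    C.comp h P.e f.1 = f.1 := by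
  have hf : f.1 = C.comp (add_zero d) (C.comp (zero_add d) P.e f.1) Q.e := f.2
  rw [hf, ← C.assoc (zero_add d) (add_zero d) (add_zero d) h,
    ← C.assoc (add_zero 0) (zero_add d) (zero_add d) (zero_add d), P.idem]

variable {C} in
theorem karHom_right {P Q : C.KarObj} {d : ℤ} (f : C.karHom P Q d) (h : d + 0 = d) :
    C.comp h f.1 Q.e = f.1 := by
  have hf : f.1 = C.comp (add_zero d) (C.comp (zero_add d) P.e f.1) Q.e := f.2
  rw [hf, C.assoc (add_zero d) h (add_zero 0) (add_zero d), Q.idem]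

variable {C} in
theorem mem_karHom {P Q : C.KarObj} {d : ℤ} {f : C.Hom P.obj Q.obj d}
    (h₁ : C.comp (zero_add d) P.e f = f) (h₂ : C.comp (add_zero d) f Q.e = f) :
    f ∈ C.karHom P Q d := by
  change f = C.comp (add_zero d) (C.comp (zero_add d) P.e f) Q.e
  rw [h₁, h₂]

variable {C} in
/-- The morphism `e' ∘ f ∘ e` of the Karoubi envelope. -/
def karProj (P Q : C.KarObj) {d : ℤ} (f : C.Hom P.obj Q.obj d) : C.karHom P Q d :=
  ⟨C.comp (add_zero d) (C.comp (zero_add d) P.e f) Q.e, mem_karHom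
    (by rw [← C.assoc (zero_add d) (add_zero d) (add_zero d) (zero_add d),
      ← C.assoc (add_zero 0) (zero_add d) (zero_add d) (zero_add d), P.idem])
    (by rw [C.assoc (add_zero d) (add_zero d) (add_zero 0) (add_zero d), Q.idem])⟩

/-- The graded Karoubi envelope. -/
def Kar : GrCat.{u, v, max v w} K where
  Obj := C.KarObj
  Hom P Q d := C.karHom P Q d
  id P := ⟨P.e, mem_karHom P.idem P.idem⟩
  comp {P Q R i j k} h := LinearMap.mk₂ K
    (fun f g => ⟨C.comp h f.1 g.1, mem_karHom
      (by rw [← C.assoc (zero_add i) h h (zero_add k), karHom_left])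
      (by rw [C.assoc h (add_zero k) (add_zero j) h, karHom_right])⟩)
    (fun f f' g => Subtype.ext (by simp))
    (fun r f g => Subtype.ext (by simp))
    (fun f g g' => Subtype.ext (by simp))
    (fun r f g => Subtype.ext (by simp))
  id_comp h f := Subtype.ext (karHom_left f h)
  comp_id h f := Subtype.ext (karHom_right f h)
  assoc h₁ h₂ h₃ h₄ f g l := Subtype.ext (C.assoc h₁ h₂ h₃ h₄ f.1 g.1 l.1)

variable {C} in
/-- A morphism of degree `d`, regarded as a morphism of degree `e` for `e = d`. -/
def castDeg {X Y : C.Obj} {d e : ℤ} (h : d = e) (f : C.Hom X Y d) : C.Hom X Y e := h ▸ f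

/-- The identity of `X`, regarded as a morphism `X ⟶ Y` of degree `d` for `Y = X` and `d = 0`. -/
def idAt {X Y : C.Obj} (h : X = Y) {d : ℤ} (hd : d = 0) : C.Hom X Y d := by
  subst h
  subst hd
  exact C.id X

variable {C} in
theorem idAt_comp {X Y : C.Obj} {d e : ℤ} (hd : d = 0) (h : d + e = e) (f : C.Hom X Y e) :
    C.comp h (C.idAt rfl hd) f = f := by
  subst hd
  exact C.id_comp h f

variable {C} in
theorem comp_idAt {X Y : C.Obj} {d e : ℤ} (hd : d = 0) (h : e + d = e) (f : C.Hom X Y e) :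
    C.comp h f (C.idAt rfl hd) = f := by
  subst hd
  exact C.comp_id h f

/-- A formal finite direct sum of shifted objects, `⨁ i, q ^ (shift i) (obj i)`. -/
structure MatObj where
  ι : Type
  [fintype : Fintype ι]
  shift : ι → ℤ
  obj : ι → C.Obj

instance (A : C.MatObj) : Fintype A.ι := A.fintype

/-- Matrices of morphisms. As `q ^ k` moves degree `d - k` to degree `d`, the degree `d` part of
`Hom (q ^ a X) (q ^ b Y) = q ^ (b - a) Hom X Y` is the part of degree `d - (b - a)` of `Hom X Y`. -/
abbrev MatHom (A B : C.MatObj) (d : ℤ) : Type v :=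
  ∀ (i : A.ι) (j : B.ι), C.Hom (A.obj i) (B.obj j) (d - (B.shift j - A.shift i))

open Classical in
/-- The identity matrix. -/
def matId (A : C.MatObj) : C.MatHom A A 0 := fun i j =>
  if h : i = j then C.idAt (congrArg A.obj h) (by rw [h]; ring) else 0

/-- The `ℤ`-additive completion: grading shifts and finite direct sums are adjoined. -/
def Mat : GrCat.{u, v, max 1 w} K where
  Obj := C.MatObj
  Hom A B d := C.MatHom A B d
  id A := C.matId A
  comp {A B D i j k} h := LinearMap.mk₂ K
    (fun f g a c => ∑ b, C.comp (by rw [← h]; ring) (f a b) (g b c))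
    (fun f f' g => by funext a c; simp [Finset.sum_add_distrib])
    (fun r f g => by funext a c; simp [Finset.smul_sum])
    (fun f g g' => by funext a c; simp [Finset.sum_add_distrib])
    (fun r f g => by funext a c; simp [Finset.smul_sum])
  id_comp {A B d} h f := by
    funext a c
    simp only [LinearMap.mk₂_apply]
    rw [Finset.sum_eq_single a]
    · simp only [matId, dite_true]
      exact idAt_comp _ _ _
    · intro b _ hb
      simp [matId, hb.symm]
    · simp
  comp_id {A B d} h f := by
    funext a c
    simp only [LinearMap.mk₂_apply]
    rw [Finset.sum_eq_single c]
    · simp only [matId, dite_true]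
      exact comp_idAt _ _ _
    · intro b _ hb
      simp [matId, hb]
    · simp
  assoc {A B D E i j k ij jk ijk} h₁ h₂ h₃ h₄ f g l := by
    funext a e
    simp only [LinearMap.mk₂_apply, map_sum, LinearMap.sum_apply]
    rw [Finset.sum_comm]
    refine Finset.sum_congr rfl fun b _ => Finset.sum_congr rfl fun c _ => ?_
    exact C.assoc _ _ _ _ _ _ _

/-- An ind-object: a diagram in the degree zero subcategory, indexed by a small filtered
category. -/
structure IndObj where
  I : Type
  [cat : SmallCategory I]
  [filt : IsFiltered I]
  F : I ⥤ C.Zero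

instance (α : C.IndObj) : SmallCategory α.I := α.cat

variable {C}

/-- The `i`-th object of the diagram. -/
def IndObj.at (α : C.IndObj) (i : α.I) : C.Obj := α.F.obj i

/-- The transition morphisms of the diagram. -/
def IndObj.tr (α : C.IndObj) {i j : α.I} (u : i ⟶ j) : C.Hom (α.at i) (α.at j) 0 := α.F.map u

theorem IndObj.tr_id (α : C.IndObj) (i : α.I) : α.tr (𝟙 i) = C.id (α.at i) := α.F.map_id i

theorem IndObj.tr_comp (α : C.IndObj) {i j k : α.I} (u : i ⟶ j) (v : j ⟶ k) :
    α.tr (u ≫ v) = C.comp (add_zero 0) (α.tr u) (α.tr v) := α.F.map_comp u v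

open Classical in
/-- The relations identifying a morphism `X ⟶ β j` with its composites along `β j ⟶ β j'`. -/
def colimRel (X : C.Obj) (β : C.IndObj) (d : ℤ) : Submodule K (⨁ j, C.Hom X (β.at j) d) :=
  Submodule.span K {x | ∃ (j j' : β.I) (u : j ⟶ j') (f : C.Hom X (β.at j) d),
    x = DirectSum.lof K β.I (fun j => C.Hom X (β.at j) d) j' (C.comp (add_zero d) f (β.tr u)) -
      DirectSum.lof K β.I (fun j => C.Hom X (β.at j) d) j f}

/-- The colimit `colim_j Hom(X, β j)` in degree `d`: the direct sum over `j`, modulo the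
identification of every element with its images under the transition maps. -/
abbrev ColimHom (X : C.Obj) (β : C.IndObj) (d : ℤ) : Type v :=
  (⨁ j, C.Hom X (β.at j) d) ⧸ colimRel X β d

open Classical in
/-- The structure maps of the colimit. -/
def toColim (X : C.Obj) (β : C.IndObj) (d : ℤ) (j : β.I) :
    C.Hom X (β.at j) d →ₗ[K] ColimHom X β d :=
  (colimRel X β d).mkQ ∘ₗ DirectSum.lof K β.I (fun j => C.Hom X (β.at j) d) j

theorem toColim_tr {X : C.Obj} {β : C.IndObj} {d : ℤ} {j j' : β.I} (u : j ⟶ j')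
    (f : C.Hom X (β.at j) d) (h : d + 0 = d) :
    toColim X β d j' (C.comp h f (β.tr u)) = toColim X β d j f := by
  classical
  refine (Submodule.Quotient.eq _).2 (Submodule.subset_span ⟨j, j', u, f, ?_⟩)
  congr!

theorem colim_induction {X : C.Obj} {β : C.IndObj} {d : ℤ} {p : ColimHom X β d → Prop}
    (add : ∀ x y, p x → p y → p (x + y)) (of : ∀ j f, p (toColim X β d j f)) (x) : p x := by
  classical
  obtain ⟨x, rfl⟩ := Submodule.mkQ_surjective _ x
  induction x using DirectSum.induction_on with
  | zero =>
    by_cases hI : Nonempty β.I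
    · obtain ⟨j⟩ := hI
      simpa using of j 0
    · exact absurd β.filt.nonempty hI
  | of j f => exact of j f
  | add x y hx hy => rw [map_add]; exact add _ _ hx hy

open Classical in
/-- The universal property of the colimit. -/
def colimDesc {X : C.Obj} {β : C.IndObj} {d : ℤ} {M : Type*} [AddCommGroup M] [Module K M]
    (φ : ∀ j, C.Hom X (β.at j) d →ₗ[K] M)
    (hφ : ∀ (j j' : β.I) (u : j ⟶ j') (f), φ j' (C.comp (add_zero d) f (β.tr u)) = φ j f) :
    ColimHom X β d →ₗ[K] M :=
  (colimRel X β d).liftQ (DirectSum.toModule K β.I M φ) (by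
    rw [colimRel, Submodule.span_le]
    rintro _ ⟨j, j', u, f, rfl⟩
    simp [hφ])

theorem colimDesc_toColim {X : C.Obj} {β : C.IndObj} {d : ℤ} {M : Type*} [AddCommGroup M]
    [Module K M] (φ : ∀ j, C.Hom X (β.at j) d →ₗ[K] M)
    (hφ : ∀ (j j' : β.I) (u : j ⟶ j') (f), φ j' (C.comp (add_zero d) f (β.tr u)) = φ j f)
    (j : β.I) (f : C.Hom X (β.at j) d) : colimDesc φ hφ (toColim X β d j f) = φ j f := by
  classical
  simp [colimDesc, toColim]

/-- Precomposition `colim_j Hom(Y, β j) ⟶ colim_j Hom(X, β j)` with `g : X ⟶ Y`. -/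
def preColim {X Y : C.Obj} (β : C.IndObj) {i d k : ℤ} (h : i + d = k) (g : C.Hom X Y i) :
    ColimHom Y β d →ₗ[K] ColimHom X β k :=
  colimDesc (fun j => toColim X β k j ∘ₗ C.comp h g) (fun j j' u f => by
    simp only [LinearMap.comp_apply]
    rw [← C.assoc h (add_zero k) (add_zero d) h, toColim_tr])

theorem preColim_toColim {X Y : C.Obj} (β : C.IndObj) {i d k : ℤ} (h : i + d = k)
    (g : C.Hom X Y i) (j : β.I) (f : C.Hom Y (β.at j) d) :
    preColim β h g (toColim Y β d j f) = toColim X β k j (C.comp h g f) :=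
  colimDesc_toColim _ _ _ _

theorem preColim_add {X Y : C.Obj} (β : C.IndObj) {i d k : ℤ} (h : i + d = k)
    (g g' : C.Hom X Y i) (x : ColimHom Y β d) :
    preColim β h (g + g') x = preColim β h g x + preColim β h g' x := by
  induction x using colim_induction with
  | add x y hx hy => rw [map_add, hx, hy, map_add, map_add]; abel
  | of j f => simp [preColim_toColim]

theorem preColim_smul {X Y : C.Obj} (β : C.IndObj) {i d k : ℤ} (h : i + d = k)
    (r : K) (g : C.Hom X Y i) (x : ColimHom Y β d) :
    preColim β h (r • g) x = r • preColim β h g x := by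
  induction x using colim_induction with
  | add x y hx hy => rw [map_add, hx, hy, map_add, smul_add]
  | of j f => simp [preColim_toColim]

theorem preColim_comp {X Y Z : C.Obj} (β : C.IndObj) {i j d k l m : ℤ} (h₁ : i + j = k)
    (h₂ : k + d = m) (h₃ : j + d = l) (h₄ : i + l = m) (f : C.Hom X Y i) (g : C.Hom Y Z j)
    (x : ColimHom Z β d) :
    preColim β h₂ (C.comp h₁ f g) x = preColim β h₄ f (preColim β h₃ g x) := by
  induction x using colim_induction with
  | add x y hx hy => simp only [map_add, hx, hy]
  | of j f => simp only [preColim_toColim]; rw [C.assoc h₁ h₂ h₃ h₄]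

theorem preColim_id {X : C.Obj} (β : C.IndObj) {d : ℤ} (h : 0 + d = d) (x : ColimHom X β d) :
    preColim β h (C.id X) x = x := by
  induction x using colim_induction with
  | add x y hx hy => rw [map_add, hx, hy]
  | of j f => rw [preColim_toColim, C.id_comp]

/-- Morphisms of ind-objects of degree `d`: the degree `d` part of `lim_i colim_j Hom(α i, β j)`,
where the limit consists of the families that are compatible with the transition maps of `α`. -/
def indHom (α β : C.IndObj) (d : ℤ) : Submodule K (∀ i, ColimHom (α.at i) β d) where
  carrier := {x | ∀ (i i' : α.I) (u : i ⟶ i'), preColim β (zero_add d) (α.tr u) (x i') = x i}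
  add_mem' hx hy i i' u := by simp [hx i i' u, hy i i' u]
  zero_mem' i i' u := by simp
  smul_mem' r x hx i i' u := by simp [hx i i' u]

/-- Postcomposition of an element of `colim_j Hom(X, β j)` with a morphism `β ⟶ γ`: represent the
element by some `f : X ⟶ β j` and precompose the `j`-th component of the morphism with `f`. -/
def postColim (X : C.Obj) {β γ : C.IndObj} {d e k : ℤ} (h : d + e = k) (g : indHom β γ e) :
    ColimHom X β d →ₗ[K] ColimHom X γ k :=
  colimDesc (fun j =>
    { toFun := fun f => preColim γ h f (g.1 j)
      map_add' := fun f f' => preColim_add γ h f f' _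
      map_smul' := fun r f => preColim_smul γ h r f _ })
    (fun j j' u f => by
      change preColim γ h (C.comp (add_zero d) f (β.tr u)) (g.1 j') = preColim γ h f (g.1 j)
      rw [preColim_comp γ (add_zero d) h (zero_add e) h, g.2 j j' u])

theorem postColim_toColim (X : C.Obj) {β γ : C.IndObj} {d e k : ℤ} (h : d + e = k)
    (g : indHom β γ e) (j : β.I) (f : C.Hom X (β.at j) d) :
    postColim X h g (toColim X β d j f) = preColim γ h f (g.1 j) :=
  colimDesc_toColim _ _ _ _

theorem postColim_preColim {X Y : C.Obj} {β γ : C.IndObj} {i d e k l m : ℤ} (h₁ : i + d = k)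
    (h₂ : k + e = m) (h₃ : d + e = l) (h₄ : i + l = m) (f : C.Hom X Y i) (g : indHom β γ e)
    (x : ColimHom Y β d) :
    postColim X h₂ g (preColim β h₁ f x) = preColim γ h₄ f (postColim Y h₃ g x) := by
  induction x using colim_induction with
  | add x y hx hy => simp only [map_add, hx, hy]
  | of j a => rw [preColim_toColim, postColim_toColim, postColim_toColim,
      preColim_comp γ h₁ h₂ h₃ h₄]

theorem postColim_add (X : C.Obj) {β γ : C.IndObj} {d e k : ℤ} (h : d + e = k)
    (g g' : indHom β γ e) (x : ColimHom X β d) :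
    postColim X h (g + g') x = postColim X h g x + postColim X h g' x := by
  induction x using colim_induction with
  | add x y hx hy => rw [map_add, hx, hy, map_add, map_add]; abel
  | of j f => simp only [postColim_toColim]; exact map_add _ _ _

theorem postColim_smul (X : C.Obj) {β γ : C.IndObj} {d e k : ℤ} (h : d + e = k)
    (r : K) (g : indHom β γ e) (x : ColimHom X β d) :
    postColim X h (r • g) x = r • postColim X h g x := by
  induction x using colim_induction with
  | add x y hx hy => rw [map_add, hx, hy, map_add, smul_add]
  | of j f => simp only [postColim_toColim]; exact LinearMap.map_smul _ _ _

/-- The identity of an ind-object. -/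
def indId (α : C.IndObj) : indHom α α 0 :=
  ⟨fun i => toColim (α.at i) α 0 i (C.id (α.at i)), fun i i' u => by
    rw [preColim_toColim, C.comp_id, ← C.id_comp (zero_add 0) (α.tr u)]
    exact toColim_tr u _ (add_zero 0)⟩

/-- The composite of two morphisms of ind-objects. -/
def indComp {α β γ : C.IndObj} {a b c : ℤ} (h : a + b = c) (f : indHom α β a) (g : indHom β γ b) :
    indHom α γ c :=
  ⟨fun i => postColim (α.at i) h g (f.1 i), fun i i' u => by
    rw [← postColim_preColim (zero_add a) h h (zero_add c), f.2 i i' u]⟩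

theorem postColim_indId {X : C.Obj} {β : C.IndObj} {d : ℤ} (h : d + 0 = d) (x : ColimHom X β d) :
    postColim X h (indId β) x = x := by
  induction x using colim_induction with
  | add x y hx hy => rw [map_add, hx, hy]
  | of j f => rw [postColim_toColim, indId, preColim_toColim, C.comp_id]

theorem postColim_indComp {X : C.Obj} {β γ δ : C.IndObj} {i j k ij jk ijk : ℤ} (h₁ : i + j = ij)
    (h₂ : ij + k = ijk) (h₃ : j + k = jk) (h₄ : i + jk = ijk) (g : indHom β γ j)
    (l : indHom γ δ k) (x : ColimHom X β i) :
    postColim X h₂ l (postColim X h₁ g x) = postColim X h₄ (indComp h₃ g l) x := by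
  induction x using colim_induction with
  | add x y hx hy => simp only [map_add, hx, hy]
  | of b f =>
    rw [postColim_toColim, postColim_toColim, postColim_preColim h₁ h₂ h₃ h₄]
    rfl

/-- Composition of morphisms of ind-objects is bilinear. -/
def indCompL {α β γ : C.IndObj} {a b c : ℤ} (h : a + b = c) :
    indHom α β a →ₗ[K] indHom β γ b →ₗ[K] indHom α γ c :=
  LinearMap.mk₂ K (indComp h)
    (fun f f' g => Subtype.ext (funext fun i => (postColim (α.at i) h g).map_add (f.1 i) (f'.1 i)))
    (fun r f g => Subtype.ext (funext fun i => (postColim (α.at i) h g).map_smul r (f.1 i)))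
    (fun f g g' => Subtype.ext (funext fun i => postColim_add (α.at i) h g g' (f.1 i)))
    (fun r f g => Subtype.ext (funext fun i => postColim_smul (α.at i) h r g (f.1 i)))

variable (C) in
/-- The ind-completion. -/
def Ind : GrCat.{u, v, max 1 v w} K where
  Obj := C.IndObj
  Hom α β d := indHom α β d
  id α := indId α
  comp h := indCompL h
  id_comp h f := Subtype.ext (funext fun i => by
    change postColim _ h f (toColim _ _ _ _ _) = f.1 i
    rw [postColim_toColim, preColim_id])
  comp_id h _ := Subtype.ext (funext fun _ => postColim_indId h _)
  assoc h₁ h₂ h₃ h₄ _ g l := Subtype.ext (funext fun _ => postColim_indComp h₁ h₂ h₃ h₄ g l _)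

end GrCat

/-! ### The symmetric group acts on anything that satisfies the Coxeter relations -/

/-- The elements `s 0, …, s (n - 2)` of a monoid satisfy the Coxeter relations of the symmetric group
on `n` letters. -/
structure Coxeter {M : Type*} [Monoid M] (n : ℕ) (s : ℕ → M) : Prop where
  sq : ∀ i, i + 1 < n → s i * s i = 1
  comm : ∀ i j, i + 2 ≤ j → j + 1 < n → s i * s j = s j * s i
  braid : ∀ i, i + 2 < n → s i * s (i + 1) * s i = s (i + 1) * s i * s (i + 1)

namespace Coxeter

/-- The product `s (j + l - 1) ⋯ s (j + 1) s j`. -/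
def desc {M : Type*} [Monoid M] (s : ℕ → M) (j : ℕ) : ℕ → M
  | 0 => 1
  | l + 1 => s (j + l) * desc s j l

/-- Labels for the normal forms of the elements of the symmetric group on `n` letters. -/
def NF : ℕ → Type
  | 0 => Unit
  | n + 1 => NF n × Fin (n + 1)

instance NF.fintype : ∀ n, Fintype (NF n)
  | 0 => inferInstanceAs (Fintype Unit)
  | n + 1 => @instFintypeProd _ _ (NF.fintype n) _

theorem NF.card : ∀ n, Fintype.card (NF n) = n.factorial
  | 0 => rfl
  | n + 1 => by
    rw [Nat.factorial_succ, ← NF.card n, mul_comm]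
    exact (Fintype.card_prod (NF n) (Fin (n + 1))).trans (by rw [Fintype.card_fin])

/-- The product with a given normal form. -/
def val {M : Type*} [Monoid M] (s : ℕ → M) : ∀ n, NF n → M
  | 0, _ => 1
  | n + 1, x => val s n x.1 * desc s x.2 (n - x.2)

variable {M : Type*} [Monoid M] {n : ℕ} {s : ℕ → M}

theorem desc_succ' (s : ℕ → M) (j l : ℕ) : desc s j (l + 1) = desc s (j + 1) l * s j := by
  induction l with
  | zero => simp [desc]
  | succ l ih =>
    rw [desc, ih, desc, mul_assoc]
    congr 2
    ring

theorem desc_comm (hs : Coxeter n s) {i j : ℕ} (hij : i + 2 ≤ j) (l : ℕ) (hl : j + l ≤ n - 1) :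
    desc s j l * s i = s i * desc s j l := by
  induction l with
  | zero => simp [desc]
  | succ l ih =>
    rw [desc, mul_assoc, ih (by omega), ← mul_assoc, ← hs.comm i (j + l) (by omega) (by omega),
      mul_assoc]

theorem desc_comm' (hs : Coxeter n s) {i j : ℕ} (l : ℕ) (hi : j + l + 1 ≤ i) (hn : i + 1 < n) :
    desc s j l * s i = s i * desc s j l := by
  induction l with
  | zero => simp [desc]
  | succ l ih =>
    rw [desc, mul_assoc, ih (by omega), ← mul_assoc, hs.comm (j + l) i (by omega) (by omega),
      mul_assoc]

theorem desc_mul (hs : Coxeter n s) {i j : ℕ} (hij : j ≤ i) (l : ℕ) (hi : i + 2 ≤ j + l)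
    (hl : j + l ≤ n - 1) : desc s j l * s (i + 1) = s i * desc s j l := by
  induction l with
  | zero => omega
  | succ l ih =>
    rcases Nat.lt_or_ge (i + 1) (j + l) with h | h
    · rw [desc, mul_assoc, ih (by omega) (by omega), ← mul_assoc, ← mul_assoc,
        hs.comm i (j + l) (by omega) (by omega)]
    · obtain ⟨l, rfl⟩ : ∃ m, l = m + 1 := ⟨l - 1, by omega⟩
      obtain rfl : i = j + l := by omega
      have e : j + (l + 1) = j + l + 1 := by ring
      rw [desc, desc, e, mul_assoc, mul_assoc, desc_comm' hs l (by omega) (by omega)]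
      simp only [← mul_assoc]
      rw [hs.braid (j + l) (by omega)]

theorem val_mul (hs : Coxeter n s) : ∀ k, k ≤ n → ∀ (x : NF k) (i : ℕ), i + 1 < k →
    ∃ y, val s k y = val s k x * s i
  | 0, _, _, i, hi => by omega
  | k + 1, hk, (x, j), i, hi => by
    have hj := j.2
    have key : ∀ i', i' + 1 < k → desc s j (k - j) * s i = s i' * desc s j (k - j) →
        ∃ y, val s (k + 1) y = val s (k + 1) (x, j) * s i := fun i' hi' h => by
      obtain ⟨y, hy⟩ := val_mul hs k (by omega) x i' hi'
      exact ⟨(y, j), by simp only [val]; rw [hy, mul_assoc, mul_assoc, h]⟩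
    rcases Nat.lt_or_ge (i + 1) j with h | h
    · exact key i (by omega) (desc_comm hs (by omega) _ (by omega))
    rcases Nat.lt_or_ge j i with h' | h'
    · obtain ⟨i, rfl⟩ : ∃ m, i = m + 1 := ⟨i - 1, by omega⟩
      exact key i (by omega) (desc_mul hs (by omega) _ (by omega) (by omega))
    rcases Nat.lt_or_ge i j with h'' | h''
    · refine ⟨(x, ⟨i, by omega⟩), ?_⟩
      have e : k - i = (k - j) + 1 := by omega
      have e' : (j : ℕ) = i + 1 := by omega
      simp only [val]
      rw [e, desc_succ', ← e', mul_assoc]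
    · refine ⟨(x, ⟨j + 1, by omega⟩), ?_⟩
      obtain rfl : i = j := by omega
      have e : k - (j : ℕ) = (k - (j + 1)) + 1 := by omega
      simp only [val]
      rw [e, desc_succ', mul_assoc, mul_assoc, hs.sq _ (by omega), mul_one]

/-- The adjacent transposition of `i` and `i + 1` (and the identity if `i + 1` is out of range). -/
def adj (n i : ℕ) : Equiv.Perm (Fin n) :=
  if h : i + 1 < n then Equiv.swap ⟨i, by omega⟩ ⟨i + 1, h⟩ else 1

theorem coxeter_adj (n : ℕ) : Coxeter n (adj n) where
  sq i hi := by simp [adj, hi]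
  comm i j hij hj := by
    simp only [adj, hj, show i + 1 < n by omega, dite_true]
    refine (Equiv.Perm.Disjoint.commute fun x => ?_).eq
    rcases eq_or_ne x ⟨i, by omega⟩ with rfl | h₁
    · right; apply Equiv.swap_apply_of_ne_of_ne <;> simp [Fin.ext_iff] <;> omega
    rcases eq_or_ne x ⟨i + 1, by omega⟩ with rfl | h₂
    · right; apply Equiv.swap_apply_of_ne_of_ne <;> simp [Fin.ext_iff] <;> omega
    · exact Or.inl (Equiv.swap_apply_of_ne_of_ne h₁ h₂)
  braid i hi := by
    simp only [adj, hi, show i + 1 < n by omega, dite_true]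
    rw [Equiv.swap_comm (⟨i, by omega⟩ : Fin n) ⟨i + 1, by omega⟩,
      Equiv.swap_comm (⟨i + 1, by omega⟩ : Fin n) ⟨i + 1 + 1, by omega⟩]
    rw [Equiv.swap_mul_swap_mul_swap (by simp) (by simp [Fin.ext_iff]; omega),
      Equiv.swap_comm (⟨i + 1 + 1, by omega⟩ : Fin n) ⟨i + 1, by omega⟩,
      Equiv.swap_comm (⟨i + 1, by omega⟩ : Fin n) ⟨i, by omega⟩,
      Equiv.swap_mul_swap_mul_swap (by simp) (by simp [Fin.ext_iff]; omega), Equiv.swap_comm]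

theorem closure_adj (n : ℕ) : Submonoid.closure {w | ∃ i, i + 1 < n ∧ w = adj n i} = ⊤ := by
  cases n with
  | zero => exact Subsingleton.elim _ _
  | succ n =>
    rw [← top_le_iff, ← Equiv.Perm.mclosure_swap_castSucc_succ]
    refine Submonoid.closure_mono ?_
    rintro _ ⟨i, rfl⟩
    refine ⟨i, by omega, ?_⟩
    simp [adj]
    rfl

theorem prod (hs : Coxeter n s) : Coxeter n fun i => (s i, adj n i) where
  sq i hi := Prod.ext (hs.sq i hi) ((coxeter_adj n).sq i hi)
  comm i j h h' := Prod.ext (hs.comm i j h h') ((coxeter_adj n).comm i j h h')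
  braid i h := Prod.ext (hs.braid i h) ((coxeter_adj n).braid i h)

/-- The graph of the homomorphism that sends adjacent transpositions to the `s i`. -/
def graph (n : ℕ) (s : ℕ → M) : Submonoid (M × Equiv.Perm (Fin n)) :=
  Submonoid.closure {w | ∃ i, i + 1 < n ∧ w = (s i, adj n i)}

theorem exists_val (hs : Coxeter n s) {w} (hw : w ∈ graph n s) :
    ∃ x, val (fun i => (s i, adj n i)) n x = w := by
  induction hw using Submonoid.closure_induction_right with
  | one =>
    have : ∀ k, ∃ x : NF k, val (fun i => (s i, adj n i)) k x = 1 := fun k => by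
      induction k with
      | zero => exact ⟨(), rfl⟩
      | succ k ih =>
        obtain ⟨x, hx⟩ := ih
        exact ⟨(x, Fin.last k), by simp [val, hx, desc]⟩
    exact this n
  | mul_right w _ v hv ih =>
    obtain ⟨i, hi, rfl⟩ := hv
    obtain ⟨x, rfl⟩ := ih
    exact val_mul hs.prod n le_rfl x i hi

theorem exists_graph (n : ℕ) (s : ℕ → M) (w : Equiv.Perm (Fin n)) : ∃ m, (m, w) ∈ graph n s := by
  have hw : w ∈ Submonoid.closure {w | ∃ i, i + 1 < n ∧ w = adj n i} := by
    rw [closure_adj]; trivial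
  induction hw using Submonoid.closure_induction with
  | mem _ h =>
    obtain ⟨i, hi, rfl⟩ := h
    exact ⟨s i, Submonoid.subset_closure ⟨i, hi, rfl⟩⟩
  | one => exact ⟨1, one_mem _⟩
  | mul _ _ _ _ h h' =>
    obtain ⟨a, ha⟩ := h
    obtain ⟨b, hb⟩ := h'
    exact ⟨a * b, mul_mem ha hb⟩

theorem graph_unique (hs : Coxeter n s) {m m' : M} {w : Equiv.Perm (Fin n)}
    (h : (m, w) ∈ graph n s) (h' : (m', w) ∈ graph n s) : m = m' := by
  have surj : Function.Surjective fun x => (val (fun i => (s i, adj n i)) n x).2 := fun w => by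
    obtain ⟨m, hm⟩ := exists_graph n s w
    obtain ⟨x, hx⟩ := exists_val hs hm
    exact ⟨x, congrArg Prod.snd hx⟩
  have inj := ((Fintype.bijective_iff_surjective_and_card _).2
    ⟨surj, by rw [NF.card, Fintype.card_perm, Fintype.card_fin]⟩).1
  obtain ⟨x, hx⟩ := exists_val hs h
  obtain ⟨y, hy⟩ := exists_val hs h'
  have : x = y := inj (by simp only [hx, hy])
  subst this
  exact congrArg Prod.fst (hx.symm.trans hy)

/-- The homomorphism from the symmetric group that sends the transposition of `i` and `i + 1` to
`s i`. -/
def lift (hs : Coxeter n s) : Equiv.Perm (Fin n) →* M where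
  toFun w := (exists_graph n s w).choose
  map_one' := graph_unique hs (exists_graph n s 1).choose_spec (one_mem _)
  map_mul' v w := graph_unique hs (exists_graph n s (v * w)).choose_spec
    (mul_mem (exists_graph n s v).choose_spec (exists_graph n s w).choose_spec)

theorem lift_adj (hs : Coxeter n s) (i : ℕ) (hi : i + 1 < n) : hs.lift (adj n i) = s i :=
  graph_unique hs (exists_graph n s (adj n i)).choose_spec
    (Submonoid.subset_closure ⟨i, hi, rfl⟩)

end Coxeter

/-! ### The dotted Temperley–Lieb category -/

/-- The elementary dotted planar tangles, with the number of bottom and of top endpoints. The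
strands are numbered `0, 1, …` from left to right.
* `cup n i`: `n` vertical strands, and a cup (local minimum) whose ends become the top endpoints
  `i` and `i + 1`;
* `cap n i`: `n` vertical strands, and a cap (local maximum) that joins the bottom endpoints `i`
  and `i + 1`;
* `dot n i`: `n` vertical strands with one dot, on strand `i`. -/
inductive Layer : ℕ → ℕ → Type
  | cup (n i : ℕ) (h : i ≤ n) : Layer n (n + 2)
  | cap (n i : ℕ) (h : i ≤ n) : Layer (n + 2) n
  | dot (n i : ℕ) (h : i < n) : Layer n n

/-- Dotted planar tangles in generic position, as stacks of elementary ones. The first layer is at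
the bottom. -/
inductive Tangle : ℕ → ℕ → Type
  | nil (n : ℕ) : Tangle n n
  | cons {a b c : ℕ} (L : Layer a b) (t : Tangle b c) : Tangle a c

namespace Tangle

/-- A one-layer tangle. -/
def of {a b : ℕ} (L : Layer a b) : Tangle a b := cons L (nil b)

/-- Vertical stacking: `append s t` is `t` on top of `s`. -/
def append : {a b c : ℕ} → Tangle a b → Tangle b c → Tangle a c
  | _, _, _, nil _, t => t
  | _, _, _, cons L s, t => cons L (append s t)

theorem append_nil {a b : ℕ} (s : Tangle a b) : append s (nil b) = s := by
  induction s with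
  | nil => rfl
  | cons L s ih => rw [append, ih]

theorem append_assoc {a b c d : ℕ} (s : Tangle a b) (t : Tangle b c) (u : Tangle c d) :
    append (append s t) u = append s (append t u) := by
  induction s with
  | nil => rfl
  | cons L s ih => rw [append, append, append, ih]

/-- The number of dots. -/
def dots : {a b : ℕ} → Tangle a b → ℕ
  | _, _, nil _ => 0
  | _, _, cons (.dot _ _ _) s => dots s + 1
  | _, _, cons (.cup _ _ _) s => dots s
  | _, _, cons (.cap _ _ _) s => dots s

/-- A dot has degree two. -/
def deg {a b : ℕ} (t : Tangle a b) : ℤ := 2 * t.dots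

theorem dots_append {a b c : ℕ} (s : Tangle a b) (t : Tangle b c) :
    (append s t).dots = s.dots + t.dots := by
  induction s with
  | nil => simp [append, dots]
  | cons L s ih => cases L <;> (simp [append, dots, ih]; try ring)

theorem deg_append {a b c : ℕ} (s : Tangle a b) (t : Tangle b c) :
    (append s t).deg = s.deg + t.deg := by
  simp only [deg, dots_append]; push_cast; ring

end Tangle

section Linear

variable (K : Type u) [Field K]

/-- Formal linear combinations of dotted planar tangles. -/
abbrev Lin (a b : ℕ) : Type u := Tangle a b →₀ K

/-- Bilinear extension of stacking. -/
def linComp {a b c : ℕ} : Lin K a b →ₗ[K] Lin K b c →ₗ[K] Lin K a c :=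
  Finsupp.linearCombination K fun s => Finsupp.lmapDomain K K fun t => Tangle.append s t

/-- A tangle as a formal linear combination. -/
def tan {a b : ℕ} (t : Tangle a b) : Lin K a b := Finsupp.single t 1

variable {K} in
theorem linComp_tan {a b c : ℕ} (s : Tangle a b) (t : Tangle b c) :
    linComp K (tan K s) (tan K t) = tan K (Tangle.append s t) := by
  simp [linComp, tan]

theorem tan_induction {a b : ℕ} {p : Lin K a b → Prop} (zero : p 0)
    (add : ∀ x y, p x → p y → p (x + y)) (smul : ∀ (r : K) x, p x → p (r • x))
    (of : ∀ t, p (tan K t)) (x) : p x := by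
  induction x using Finsupp.induction_linear with
  | zero => exact zero
  | add x y hx hy => exact add x y hx hy
  | single t r => simpa [tan] using smul r _ (of t)

variable {K} in
theorem linComp_assoc {a b c d : ℕ} (x : Lin K a b) (y : Lin K b c) (z : Lin K c d) :
    linComp K (linComp K x y) z = linComp K x (linComp K y z) := by
  induction x using tan_induction with
  | zero => simp
  | add x x' h h' => simp [h, h']
  | smul r x h => simp [h]
  | of s =>
    induction y using tan_induction with
    | zero => simp
    | add x x' h h' => simp [h, h']
    | smul r x h => simp [h]
    | of t =>
      induction z using tan_induction with
      | zero => simp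
      | add x x' h h' => simp [h, h']
      | smul r x h => simp [h]
      | of u => simp only [linComp_tan, Tangle.append_assoc]

/-! The elementary tangles, as linear combinations. -/

def cupL (n i : ℕ) (h : i ≤ n) : Lin K n (n + 2) := tan K (.of (.cup n i h))

def capL (n i : ℕ) (h : i ≤ n) : Lin K (n + 2) n := tan K (.of (.cap n i h))

def dotL (n i : ℕ) (h : i < n) : Lin K n n := tan K (.of (.dot n i h))

/-- The identity tangle. -/
def idL (n : ℕ) : Lin K n n := tan K (.nil n)

/-- `x ⊡ y` is `y` stacked on top of `x`. -/
notation:70 x:70 " ⊡ " y:71 => linComp _ x y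

/-- The defining relations `x = y` of the dotted Temperley–Lieb category. The first three groups
generate planar isotopy: distant layers can be exchanged, a zigzag can be straightened, and a dot
can slide over a cup or a cap. The last group consists of the three local relations. -/
inductive Rel : {a b : ℕ} → Lin K a b → Lin K a b → Prop
  -- exchange of distant layers
  | cup_cup (n i j : ℕ) (hij : i ≤ j) (hj : j ≤ n) :
      Rel (cupL K n j hj ⊡ cupL K (n + 2) i (by omega))
        (cupL K n i (by omega) ⊡ cupL K (n + 2) (j + 2) (by omega))
  | cap_cap (n i j : ℕ) (hij : i ≤ j) (hj : j ≤ n) :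
      Rel (capL K (n + 2) i (by omega) ⊡ capL K n j hj)
        (capL K (n + 2) (j + 2) (by omega) ⊡ capL K n i (by omega))
  | cap_cup_left (n i j : ℕ) (hij : i ≤ j) (hj : j ≤ n) :
      Rel (capL K n j hj ⊡ cupL K n i (by omega))
        (cupL K (n + 2) i (by omega) ⊡ capL K (n + 2) (j + 2) (by omega))
  | cap_cup_right (n i j : ℕ) (hij : i ≤ j) (hj : j ≤ n) :
      Rel (capL K n i (by omega) ⊡ cupL K n j hj)
        (cupL K (n + 2) (j + 2) (by omega) ⊡ capL K (n + 2) i (by omega))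
  | dot_dot (n i j : ℕ) (hi : i < n) (hj : j < n) :
      Rel (dotL K n i hi ⊡ dotL K n j hj) (dotL K n j hj ⊡ dotL K n i hi)
  | dot_cup_left (n i j : ℕ) (hij : j < i) (hi : i ≤ n) :
      Rel (dotL K n j (by omega) ⊡ cupL K n i hi) (cupL K n i hi ⊡ dotL K (n + 2) j (by omega))
  | dot_cup_right (n i j : ℕ) (hij : i ≤ j) (hj : j < n) :
      Rel (dotL K n j hj ⊡ cupL K n i (by omega))
        (cupL K n i (by omega) ⊡ dotL K (n + 2) (j + 2) (by omega))
  | dot_cap_left (n i j : ℕ) (hij : j < i) (hi : i ≤ n) :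
      Rel (capL K n i hi ⊡ dotL K n j (by omega)) (dotL K (n + 2) j (by omega) ⊡ capL K n i hi)
  | dot_cap_right (n i j : ℕ) (hij : i ≤ j) (hj : j < n) :
      Rel (capL K n i (by omega) ⊡ dotL K n j hj)
        (dotL K (n + 2) (j + 2) (by omega) ⊡ capL K n i (by omega))
  -- straightening of zigzags
  | zigzag_right (n i : ℕ) (h : i < n) :
      Rel (cupL K n i h.le ⊡ capL K n (i + 1) h) (idL K n)
  | zigzag_left (n i : ℕ) (h : i < n) :
      Rel (cupL K n (i + 1) h ⊡ capL K n i h.le) (idL K n)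
  -- sliding of dots
  | dot_slide_cup (n i : ℕ) (h : i ≤ n) :
      Rel (cupL K n i h ⊡ dotL K (n + 2) i (by omega))
        (cupL K n i h ⊡ dotL K (n + 2) (i + 1) (by omega))
  | dot_slide_cap (n i : ℕ) (h : i ≤ n) :
      Rel (dotL K (n + 2) i (by omega) ⊡ capL K n i h)
        (dotL K (n + 2) (i + 1) (by omega) ⊡ capL K n i h)
  -- a circle equals two
  | circle (n i : ℕ) (h : i ≤ n) :
      Rel (cupL K n i h ⊡ capL K n i h) ((2 : K) • idL K n)
  -- two dots on a strand are zero
  | two_dots (n i : ℕ) (h : i < n) : Rel (dotL K n i h ⊡ dotL K n i h) 0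
  -- the sum of a dot on the left and a dot on the right of two adjacent strands equals the sum of
  -- the cap below a cup with the dot on the cap, and the same with the dot on the cup
  | neck (n i : ℕ) (h : i ≤ n) :
      Rel (dotL K (n + 2) i (by omega) + dotL K (n + 2) (i + 1) (by omega))
        (dotL K (n + 2) i (by omega) ⊡ capL K n i h ⊡ cupL K n i h +
          capL K n i h ⊡ cupL K n i h ⊡ dotL K (n + 2) i (by omega))

/-- The ideal generated by the relations. As these are imposed with any number of vertical strands on
either side, it suffices to close up under stacking. -/
def relIdeal (a b : ℕ) : Submodule K (Lin K a b) :=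
  Submodule.span K {z | ∃ (c d : ℕ) (s : Tangle a c) (x y : Lin K c d) (t : Tangle d b),
    Rel K x y ∧ z = tan K s ⊡ (x - y) ⊡ tan K t}

/-- Dotted planar tangles modulo planar isotopy and the local relations: the direct sum over all
degrees of the morphism spaces of the dotted Temperley–Lieb category. -/
abbrev Skein (a b : ℕ) : Type u := Lin K a b ⧸ relIdeal K a b

variable {K} in
theorem linComp_mem_left {a b c : ℕ} {x : Lin K a b} (hx : x ∈ relIdeal K a b) (y : Lin K b c) :
    x ⊡ y ∈ relIdeal K a c := by
  induction y using tan_induction with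
  | zero => simp
  | add y y' h h' => rw [map_add]; exact add_mem h h'
  | smul r y h => rw [map_smul]; exact Submodule.smul_mem _ r h
  | of t =>
    induction hx using Submodule.span_induction with
    | zero => simp
    | add x x' _ _ h h' => rw [LinearMap.map_add₂]; exact add_mem h h'
    | smul r x _ h => rw [LinearMap.map_smul₂]; exact Submodule.smul_mem _ r h
    | mem x h =>
      obtain ⟨d, e, s, x, y, u, hxy, rfl⟩ := h
      refine Submodule.subset_span ⟨d, e, s, x, y, Tangle.append u t, hxy, ?_⟩
      rw [linComp_assoc, linComp_tan]

variable {K} in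
theorem linComp_mem_right {a b c : ℕ} (x : Lin K a b) {y : Lin K b c} (hy : y ∈ relIdeal K b c) :
    x ⊡ y ∈ relIdeal K a c := by
  induction x using tan_induction with
  | zero => simp
  | add x x' h h' => rw [LinearMap.map_add₂]; exact add_mem h h'
  | smul r x h => rw [LinearMap.map_smul₂]; exact Submodule.smul_mem _ r h
  | of t =>
    induction hy using Submodule.span_induction with
    | zero => simp
    | add y y' _ _ h h' => rw [map_add]; exact add_mem h h'
    | smul r y _ h => rw [map_smul]; exact Submodule.smul_mem _ r h
    | mem y h =>
      obtain ⟨d, e, s, x, y, u, hxy, rfl⟩ := h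
      refine Submodule.subset_span ⟨d, e, Tangle.append t s, x, y, u, hxy, ?_⟩
      rw [← linComp_assoc, ← linComp_assoc, linComp_tan]

/-- Stacking, on equivalence classes. -/
def skComp {a b c : ℕ} : Skein K a b →ₗ[K] Skein K b c →ₗ[K] Skein K a c :=
  LinearMap.flip <| (relIdeal K b c).liftQ
    (LinearMap.flip <| (relIdeal K a b).liftQ ((linComp K).compr₂ (relIdeal K a c).mkQ)
      (fun _ hx => LinearMap.ext fun y =>
        (Submodule.Quotient.mk_eq_zero _).2 (linComp_mem_left hx y)))
    (fun _ hy => LinearMap.ext fun x => by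
      obtain ⟨x, rfl⟩ := Submodule.mkQ_surjective _ x
      exact (Submodule.Quotient.mk_eq_zero _).2 (linComp_mem_right x hy))

/-- The class of a linear combination of tangles. -/
def cls {a b : ℕ} : Lin K a b →ₗ[K] Skein K a b := (relIdeal K a b).mkQ

variable {K}

theorem skComp_cls {a b c : ℕ} (x : Lin K a b) (y : Lin K b c) :
    skComp K (cls K x) (cls K y) = cls K (x ⊡ y) := rfl

theorem cls_surjective {a b : ℕ} (x : Skein K a b) : ∃ y, cls K y = x :=
  Submodule.mkQ_surjective _ x

theorem skComp_assoc {a b c d : ℕ} (x : Skein K a b) (y : Skein K b c) (z : Skein K c d) :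
    skComp K (skComp K x y) z = skComp K x (skComp K y z) := by
  obtain ⟨x, rfl⟩ := cls_surjective x
  obtain ⟨y, rfl⟩ := cls_surjective y
  obtain ⟨z, rfl⟩ := cls_surjective z
  simp only [skComp_cls, linComp_assoc]

theorem skComp_id {a b : ℕ} (x : Skein K a b) : skComp K x (cls K (idL K b)) = x := by
  obtain ⟨x, rfl⟩ := cls_surjective x
  rw [skComp_cls]
  congr 1
  induction x using tan_induction with
  | zero => simp
  | add x x' h h' => simp [h, h']
  | smul r x h => simp [h]
  | of s => rw [idL, linComp_tan, Tangle.append_nil]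

theorem id_skComp {a b : ℕ} (x : Skein K a b) : skComp K (cls K (idL K a)) x = x := by
  obtain ⟨x, rfl⟩ := cls_surjective x
  rw [skComp_cls]
  congr 1
  induction x using tan_induction with
  | zero => simp
  | add x x' h h' => simp [h, h']
  | smul r x h => simp [h]
  | of s => rw [idL, linComp_tan, Tangle.append]

theorem idL_comp {a b : ℕ} (x : Lin K a b) : idL K a ⊡ x = x := by
  induction x using tan_induction with
  | zero => simp
  | add x x' h h' => simp [h, h']
  | smul r x h => simp [h]
  | of s => rw [idL, linComp_tan, Tangle.append]

theorem comp_idL {a b : ℕ} (x : Lin K a b) : x ⊡ idL K b = x := by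
  induction x using tan_induction with
  | zero => simp
  | add x x' h h' => simp [h, h']
  | smul r x h => simp [h]
  | of s => rw [idL, linComp_tan, Tangle.append_nil]

/-- The defining relations hold. -/
theorem cls_eq {a b : ℕ} {x y : Lin K a b} (h : Rel K x y) : cls K x = cls K y := by
  refine (Submodule.Quotient.eq _).2 (Submodule.subset_span ⟨a, b, .nil a, x, y, .nil b, h, ?_⟩)
  exact ((comp_idL _).trans (idL_comp _)).symm

variable (K)

/-- The morphisms of degree `d`: the span of the tangles of degree `d`. (The relations are
homogeneous.) -/
def skDeg (a b : ℕ) (d : ℤ) : Submodule K (Skein K a b) :=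
  Submodule.span K {x | ∃ t : Tangle a b, t.deg = d ∧ x = cls K (tan K t)}

variable {K}

theorem cls_mem_skDeg {a b : ℕ} (t : Tangle a b) {d : ℤ} (h : t.deg = d) :
    cls K (tan K t) ∈ skDeg K a b d :=
  Submodule.subset_span ⟨t, h, rfl⟩

theorem skComp_mem {a b c : ℕ} {i j k : ℤ} (h : i + j = k) {x : Skein K a b} {y : Skein K b c}
    (hx : x ∈ skDeg K a b i) (hy : y ∈ skDeg K b c j) : skComp K x y ∈ skDeg K a c k := by
  induction hx using Submodule.span_induction with
  | zero => simp
  | add x x' _ _ h h' => rw [LinearMap.map_add₂]; exact add_mem h h'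
  | smul r x _ h => rw [LinearMap.map_smul₂]; exact Submodule.smul_mem _ r h
  | mem x hx =>
    induction hy using Submodule.span_induction with
    | zero => simp
    | add y y' _ _ h h' => rw [map_add]; exact add_mem h h'
    | smul r y _ h => rw [map_smul]; exact Submodule.smul_mem _ r h
    | mem y hy =>
      obtain ⟨s, hs, rfl⟩ := hx
      obtain ⟨t, ht, rfl⟩ := hy
      rw [skComp_cls, linComp_tan]
      exact cls_mem_skDeg _ (by rw [Tangle.deg_append, hs, ht, h])

theorem idL_mem (n : ℕ) : cls K (idL K n) ∈ skDeg K n n 0 := cls_mem_skDeg _ rfl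

theorem cupL_mem (n i : ℕ) (h : i ≤ n) : cls K (cupL K n i h) ∈ skDeg K n (n + 2) 0 :=
  cls_mem_skDeg _ rfl

theorem capL_mem (n i : ℕ) (h : i ≤ n) : cls K (capL K n i h) ∈ skDeg K (n + 2) n 0 :=
  cls_mem_skDeg _ rfl

theorem dotL_mem (n i : ℕ) (h : i < n) : cls K (dotL K n i h) ∈ skDeg K n n 2 :=
  cls_mem_skDeg _ rfl

variable (K)

/-- The dotted Temperley–Lieb category: the object `n` is the `n`-th tensor power of the generating
object. -/
def dTL : GrCat.{u, u, 0} K where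
  Obj := ℕ
  Hom a b d := skDeg K a b d
  homGroup a b d := (skDeg K a b d).addCommGroup
  homModule a b d := (skDeg K a b d).module
  id n := ⟨cls K (idL K n), idL_mem n⟩
  comp h := LinearMap.mk₂ K (fun f g => ⟨skComp K f.1 g.1, skComp_mem h f.2 g.2⟩)
    (fun f f' g => Subtype.ext (LinearMap.map_add₂ (skComp K) f.1 f'.1 g.1))
    (fun r f g => Subtype.ext (LinearMap.map_smul₂ (skComp K) r f.1 g.1))
    (fun f g g' => Subtype.ext ((skComp K f.1).map_add g.1 g'.1))
    (fun r f g => Subtype.ext ((skComp K f.1).map_smul r g.1))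
  id_comp _ f := Subtype.ext (id_skComp f.1)
  comp_id _ f := Subtype.ext (skComp_id f.1)
  assoc _ _ _ _ f g l := Subtype.ext (skComp_assoc f.1 g.1 l.1)

/-! ### Symmetrizers and Kirby objects -/

/-- A cap below a cup, at the strands `i` and `i + 1`. -/
def turnback (n i : ℕ) (h : i ≤ n) : Lin K (n + 2) (n + 2) := capL K n i h ⊡ cupL K n i h

theorem turnback_mem (n i : ℕ) (h : i ≤ n) : cls K (turnback K n i h) ∈ skDeg K (n + 2) (n + 2) 0 :=
  skComp_mem (add_zero 0) (capL_mem n i h) (cupL_mem n i h)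

/-- The `n`-th tensor power of the generating object. -/
def gen (n : ℕ) : (dTL K).Obj := n

/-- The turnback as a degree zero endomorphism. -/
def tb (n i : ℕ) (h : i ≤ n) : (dTL K).End₀ (gen K (n + 2)) :=
  ⟨cls K (turnback K n i h), turnback_mem K n i h⟩

/-- The endomorphism "identity minus turnback" of the `n`-th tensor power at the strands `i` and
`i + 1`, for `i + 1 < n`, which plays the role of the crossing of these two strands. (For other `i`
it is the identity, by convention.) -/
def crossing : (n i : ℕ) → (dTL K).End₀ (gen K n)
  | n + 2, i => if h : i ≤ n then 1 - tb K n i h else 1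
  | 0, _ => 1
  | 1, _ => 1

theorem tb_sq (n i : ℕ) (h : i ≤ n) : tb K n i h * tb K n i h = tb K n i h + tb K n i h := by
  refine Subtype.ext ?_
  change skComp K (skComp K (cls K (capL K n i h)) (cls K (cupL K n i h)))
    (skComp K (cls K (capL K n i h)) (cls K (cupL K n i h))) =
    skComp K (cls K (capL K n i h)) (cls K (cupL K n i h)) +
    skComp K (cls K (capL K n i h)) (cls K (cupL K n i h))
  rw [skComp_assoc, ← skComp_assoc (cls K (cupL K n i h)), skComp_cls (cupL K n i h),
    cls_eq (Rel.circle n i h), map_smul, LinearMap.map_smul₂, id_skComp, map_smul, two_smul]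

theorem tb_comm (n i j : ℕ) (hij : i ≤ j) (hj : j ≤ n) :
    tb K (n + 2) i (by omega) * tb K (n + 2) (j + 2) (by omega) =
      tb K (n + 2) (j + 2) (by omega) * tb K (n + 2) i (by omega) := by
  refine Subtype.ext (Eq.symm ?_)
  change skComp K (skComp K (cls K (capL K (n + 2) i _)) (cls K (cupL K (n + 2) i _)))
    (skComp K (cls K (capL K (n + 2) (j + 2) _)) (cls K (cupL K (n + 2) (j + 2) _))) =
    skComp K (skComp K (cls K (capL K (n + 2) (j + 2) _)) (cls K (cupL K (n + 2) (j + 2) _)))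
    (skComp K (cls K (capL K (n + 2) i _)) (cls K (cupL K (n + 2) i _)))
  rw [skComp_assoc, ← skComp_assoc (cls K (cupL K (n + 2) i _)), skComp_cls (cupL K (n + 2) i _),
    ← cls_eq (Rel.cap_cup_left n i j hij hj), ← skComp_cls, skComp_assoc, skComp_cls (cupL K n i _),
    ← cls_eq (Rel.cup_cup n i j hij hj), ← skComp_assoc, skComp_cls (capL K (n + 2) i _),
    cls_eq (Rel.cap_cap n i j hij hj), ← skComp_cls, ← skComp_cls, skComp_assoc,
    ← skComp_assoc (cls K (capL K n i _)), skComp_cls (capL K n i _),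
    cls_eq (Rel.cap_cup_right n i j hij hj), ← skComp_cls, skComp_assoc, skComp_assoc]

theorem tb_braid (n i : ℕ) (h : i < n) :
    tb K n i h.le * tb K n (i + 1) h * tb K n i h.le = tb K n i h.le := by
  refine Subtype.ext ?_
  change skComp K (skComp K (cls K (capL K n i _)) (cls K (cupL K n i _)))
    (skComp K (skComp K (cls K (capL K n (i + 1) _)) (cls K (cupL K n (i + 1) _)))
      (skComp K (cls K (capL K n i _)) (cls K (cupL K n i _)))) =
    skComp K (cls K (capL K n i _)) (cls K (cupL K n i _))
  rw [skComp_assoc, skComp_assoc, ← skComp_assoc (cls K (cupL K n i _)), skComp_cls (cupL K n i _),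
    cls_eq (Rel.zigzag_right n i h), id_skComp, ← skComp_assoc (cls K (cupL K n (i + 1) _)),
    skComp_cls (cupL K n (i + 1) _), cls_eq (Rel.zigzag_left n i h), id_skComp]

theorem tb_braid' (n i : ℕ) (h : i < n) :
    tb K n (i + 1) h * tb K n i h.le * tb K n (i + 1) h = tb K n (i + 1) h := by
  refine Subtype.ext ?_
  change skComp K (skComp K (cls K (capL K n (i + 1) _)) (cls K (cupL K n (i + 1) _)))
    (skComp K (skComp K (cls K (capL K n i _)) (cls K (cupL K n i _)))
      (skComp K (cls K (capL K n (i + 1) _)) (cls K (cupL K n (i + 1) _)))) =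
    skComp K (cls K (capL K n (i + 1) _)) (cls K (cupL K n (i + 1) _))
  rw [skComp_assoc, skComp_assoc, ← skComp_assoc (cls K (cupL K n (i + 1) _)),
    skComp_cls (cupL K n (i + 1) _), cls_eq (Rel.zigzag_left n i h), id_skComp,
    ← skComp_assoc (cls K (cupL K n i _)), skComp_cls (cupL K n i _),
    cls_eq (Rel.zigzag_right n i h), id_skComp]

theorem coxeter_crossing (n : ℕ) : Coxeter n (crossing K n) where
  sq i hi := by
    obtain ⟨n, rfl⟩ : ∃ m, n = m + 2 := ⟨n - 2, by omega⟩
    simp only [crossing, show i ≤ n by omega, dite_true]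
    rw [sub_mul, mul_sub, mul_sub, tb_sq]
    noncomm_ring
  comm i j hij hj := by
    obtain ⟨n, rfl⟩ : ∃ m, n = m + 4 := ⟨n - 4, by omega⟩
    obtain ⟨j, rfl⟩ : ∃ m, j = m + 2 := ⟨j - 2, by omega⟩
    simp only [crossing, show i ≤ n + 2 by omega, show j + 2 ≤ n + 2 by omega, dite_true]
    rw [sub_mul, sub_mul, mul_sub, mul_sub, tb_comm K n i j (by omega) (by omega)]
    noncomm_ring
  braid i hi := by
    obtain ⟨n, rfl⟩ : ∃ m, n = m + 2 := ⟨n - 2, by omega⟩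
    simp only [crossing, show i ≤ n by omega, show i + 1 ≤ n by omega, dite_true]
    have h₁ := tb_sq K n i (by omega)
    have h₂ := tb_sq K n (i + 1) (by omega)
    have h₃ := tb_braid K n i (by omega)
    have h₄ := tb_braid' K n i (by omega)
    generalize tb K n i _ = a at *
    generalize tb K n (i + 1) _ = b at *
    have e₁ : (1 - a) * (1 - b) * (1 - a) = 1 - a - a - b + a * a + a * b + b * a - a * b * a := by
      noncomm_ring
    have e₂ : (1 - b) * (1 - a) * (1 - b) = 1 - b - b - a + b * b + a * b + b * a - b * a * b := by
      noncomm_ring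
    rw [e₁, e₂, h₁, h₂, h₃, h₄]
    abel

/-- The action of the symmetric group on the `n`-th tensor power, where adjacent transpositions act
by crossings. -/
def permAct (n : ℕ) : Equiv.Perm (Fin n) →* (dTL K).End₀ (gen K n) := (coxeter_crossing K n).lift

/-- The symmetrizing idempotent (Jones–Wenzl projector). -/
def symm (n : ℕ) : (dTL K).End₀ (gen K n) := (n.factorial : K)⁻¹ • ∑ w, permAct K n w

theorem symm_idem [CharZero K] (n : ℕ) : symm K n * symm K n = symm K n := by
  have h : ∀ w, permAct K n w * ∑ w, permAct K n w = ∑ w, permAct K n w := fun w => by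
    rw [Finset.mul_sum]
    simp only [← map_mul]
    exact Fintype.sum_equiv (Equiv.mulLeft w) _ _ fun _ => rfl
  have hn : (n.factorial : K) ≠ 0 := by exact_mod_cast n.factorial_ne_zero
  rw [symm, smul_mul_smul_comm, Finset.sum_mul, Finset.sum_congr rfl fun w _ => h w,
    Finset.sum_const, Finset.card_univ, Fintype.card_perm, Fintype.card_fin,
    ← Nat.cast_smul_eq_nsmul K, smul_smul, mul_assoc, inv_mul_cancel₀ hn, mul_one]

variable [CharZero K]

/-- The `n`-th symmetric power of the generating object. -/
def symObj (n : ℕ) : (dTL K).KarObj := ⟨gen K n, symm K n, symm_idem K n⟩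

/-- `n` vertical strands, and a dotted cup to their right. -/
def dotCup (n : ℕ) : (dTL K).Hom (gen K n) (gen K (n + 2)) 2 :=
  ⟨cls K (cupL K n n le_rfl ⊡ dotL K (n + 2) n (by omega)),
    skComp_mem (zero_add 2) (cupL_mem n n le_rfl) (dotL_mem (n + 2) n (by omega))⟩

/-- The morphism from the `n`-th to the `(n + 2)`-nd symmetric power induced by a dotted cup. -/
def symCup (n : ℕ) : (dTL K).Kar.Hom (symObj K n) (symObj K (n + 2)) 2 :=
  GrCat.karProj (symObj K n) (symObj K (n + 2)) (dotCup K n)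

/-- The completed category: the ind-completion of the additive completion of the Karoubi envelope of
the dotted Temperley–Lieb category. -/
def dTLbar : GrCat.{u, u, max 1 u} K := (dTL K).Kar.Mat.Ind

/-- The object `q ^ (-n) Sym ^ n`. -/
def shiftSym (n : ℕ) : (dTL K).Kar.MatObj := ⟨Unit, fun _ => -(n : ℤ), fun _ => symObj K n⟩

/-- The dotted cup between shifted symmetric powers, which is now a morphism of degree zero. -/
def shiftCup (n : ℕ) : (dTL K).Kar.MatHom (shiftSym K n) (shiftSym K (n + 2)) 0 :=
  fun _ _ => GrCat.castDeg (by simp only [shiftSym]; push_cast; ring) (symCup K n)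

/-- The directed system `q ^ (-k) Sym ^ k ⟶ q ^ (-k - 2) Sym ^ (k + 2) ⟶ ⋯`. -/
def kirbySystem (k : ℕ) : ℕ ⥤ (dTL K).Kar.Mat.Zero :=
  Functor.ofSequence (X := fun n => shiftSym K (k + 2 * n)) fun n => shiftCup K (k + 2 * n)

/-- The Kirby object of winding number `i`. -/
def kirby (i : ℤ) : (dTLbar K).Obj :=
  ({ I := ℕ, F := kirbySystem K i.natAbs } : (dTL K).Kar.Mat.IndObj)

end Linear

end

end KirbyColor

/-! The morphism spaces between symmetrizers `P_m → P_n` are at most one-dimensional in each degree,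
and the powers of a single central element of degree two fill them wherever they matter.

The generator is `z = ∑ (-1)^i x_i`, the alternating sum of the dots (`altDot`). At a cup or a cap
the two neighbouring dots slide onto each other with opposite signs and cancel, so `z` commutes with
every tangle (`altDot_central`). It therefore commutes with the transition maps and acts on each
Kirby object.

Upper bound: on top of `P_m`, the neck relation moves any dot to the last strand, where it is a
dotted cup bent back by a cap (`dcupS_capS`). Most caps on `P_m` with dotted cups beside it vanish:
two dots on a strand, a dotted circle and a capped symmetrizer are all zero. What is left is `P_m`
with `a` dotted cups and `r` nested caps, followed by undotted cups (`symS_tangle_mem`). The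
symmetrizer `P_n` kills the undotted cups, and counting strands determines `r`. Between terms of the
Kirby system, along its arrows, the shifts turn this into: at most one dimension in degree `2 r`,
`r` a natural number, and zero in every other degree.

Lower bound: tangles act contravariantly on covectors of tensor powers of a plane with an
antisymmetric form and a nilpotent dot. A covector that depends only on the number `k` of letters
`true`, through a function `g`, is fixed by symmetrizers and is pulled back by a dotted cup to the
covector of the same `g`. So pulling back the constant covector `1` and evaluating at the word
`true, true, …` gives a functional on the colimit. Since `z` acts by `g(k) ↦ k g(k - 1)`, its power
`z^a` on `P_n` has value `n (n - 1) ⋯ (n - a + 1)`, nonzero for `n ≥ a` in characteristic zero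
(`toColim_altHom_ne_zero`). The same value shows that `z^a` followed by a transition map spans its
morphism space (`eq_smul_altHom_comp_kirbyTr`), and `hasPolynomialEnd_ind` passes to `lim colim`. -/

namespace KirbyColor

noncomputable section

section SkeinRelations

/-! ### Elementary tangles and relations between them -/

variable (K : Type u) [Field K]

/-- The class of a cup, zero if out of range. -/
def cupS (n i : ℕ) : Skein K n (n + 2) := if h : i ≤ n then cls K (cupL K n i h) else 0

/-- The class of a cap, zero if out of range. -/
def capS (n i : ℕ) : Skein K (n + 2) n := if h : i ≤ n then cls K (capL K n i h) else 0

/-- The class of a dot, zero if out of range. -/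
def dotS (n i : ℕ) : Skein K n n := if h : i < n then cls K (dotL K n i h) else 0

/-- The class of the identity. -/
def idS (n : ℕ) : Skein K n n := cls K (idL K n)

local infixl:70 " ⊚ " => skComp _

variable {K}

theorem comp_idS {a b : ℕ} (x : Skein K a b) : x ⊚ idS K b = x := skComp_id x

theorem idS_comp {a b : ℕ} (x : Skein K a b) : idS K a ⊚ x = x := id_skComp x

theorem cupS_cupS {n i j : ℕ} (hij : i ≤ j) (hj : j ≤ n) :
    cupS K n j ⊚ cupS K (n + 2) i = cupS K n i ⊚ cupS K (n + 2) (j + 2) := by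
  simp only [cupS, hj, show i ≤ n by omega, show i ≤ n + 2 by omega,
    show j + 2 ≤ n + 2 by omega, dite_true]
  exact cls_eq (Rel.cup_cup n i j hij hj)

theorem capS_capS {n i j : ℕ} (hij : i ≤ j) (hj : j ≤ n) :
    capS K (n + 2) i ⊚ capS K n j = capS K (n + 2) (j + 2) ⊚ capS K n i := by
  simp only [capS, hj, show i ≤ n by omega, show i ≤ n + 2 by omega,
    show j + 2 ≤ n + 2 by omega, dite_true]
  exact cls_eq (Rel.cap_cap n i j hij hj)

theorem cupS_capS_left {n i j : ℕ} (hij : i ≤ j) (hj : j ≤ n) :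
    cupS K (n + 2) i ⊚ capS K (n + 2) (j + 2) = capS K n j ⊚ cupS K n i := by
  simp only [cupS, capS, hj, show i ≤ n by omega, show i ≤ n + 2 by omega,
    show j + 2 ≤ n + 2 by omega, dite_true]
  exact (cls_eq (Rel.cap_cup_left n i j hij hj)).symm

theorem cupS_capS_right {n i j : ℕ} (hij : i ≤ j) (hj : j ≤ n) :
    cupS K (n + 2) (j + 2) ⊚ capS K (n + 2) i = capS K n i ⊚ cupS K n j := by
  simp only [cupS, capS, hj, show i ≤ n by omega, show i ≤ n + 2 by omega,
    show j + 2 ≤ n + 2 by omega, dite_true]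
  exact (cls_eq (Rel.cap_cup_right n i j hij hj)).symm

theorem dotS_comm (n i j : ℕ) : dotS K n i ⊚ dotS K n j = dotS K n j ⊚ dotS K n i := by
  by_cases hi : i < n
  · by_cases hj : j < n
    · simp only [dotS, hi, hj, dite_true]
      exact cls_eq (Rel.dot_dot n i j hi hj)
    · simp [dotS, hj]
  · simp [dotS, hi]

theorem cupS_dotS_left {n i j : ℕ} (hij : j < i) (hi : i ≤ n) :
    cupS K n i ⊚ dotS K (n + 2) j = dotS K n j ⊚ cupS K n i := by
  simp only [cupS, dotS, hi, show j < n by omega, show j < n + 2 by omega, dite_true]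
  exact (cls_eq (Rel.dot_cup_left n i j hij hi)).symm

theorem cupS_dotS_right {n i j : ℕ} (hij : i ≤ j) (hj : j < n) :
    cupS K n i ⊚ dotS K (n + 2) (j + 2) = dotS K n j ⊚ cupS K n i := by
  simp only [cupS, dotS, hj, show i ≤ n by omega, show j + 2 < n + 2 by omega, dite_true]
  exact (cls_eq (Rel.dot_cup_right n i j hij hj)).symm

theorem capS_dotS_left {n i j : ℕ} (hij : j < i) (hi : i ≤ n) :
    capS K n i ⊚ dotS K n j = dotS K (n + 2) j ⊚ capS K n i := by
  simp only [capS, dotS, hi, show j < n by omega, show j < n + 2 by omega, dite_true]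
  exact cls_eq (Rel.dot_cap_left n i j hij hi)

theorem capS_dotS_right {n i j : ℕ} (hij : i ≤ j) (hj : j < n) :
    capS K n i ⊚ dotS K n j = dotS K (n + 2) (j + 2) ⊚ capS K n i := by
  simp only [capS, dotS, hj, show i ≤ n by omega, show j + 2 < n + 2 by omega, dite_true]
  exact cls_eq (Rel.dot_cap_right n i j hij hj)

theorem zigzag_right {n i : ℕ} (h : i < n) : cupS K n i ⊚ capS K n (i + 1) = idS K n := by
  simp only [capS, cupS, h.le, show i + 1 ≤ n by omega, dite_true]
  exact cls_eq (Rel.zigzag_right n i h)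

theorem zigzag_left {n i : ℕ} (h : i < n) : cupS K n (i + 1) ⊚ capS K n i = idS K n := by
  simp only [capS, cupS, h.le, show i + 1 ≤ n by omega, dite_true]
  exact cls_eq (Rel.zigzag_left n i h)

theorem cupS_dotS (n i : ℕ) :
    cupS K n i ⊚ dotS K (n + 2) (i + 1) = cupS K n i ⊚ dotS K (n + 2) i := by
  by_cases h : i ≤ n
  · simp only [cupS, dotS, h, show i + 1 < n + 2 by omega, show i < n + 2 by omega, dite_true]
    exact (cls_eq (Rel.dot_slide_cup n i h)).symm
  · simp [cupS, h]

theorem dotS_capS (n i : ℕ) :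
    dotS K (n + 2) (i + 1) ⊚ capS K n i = dotS K (n + 2) i ⊚ capS K n i := by
  by_cases h : i ≤ n
  · simp only [capS, dotS, h, show i + 1 < n + 2 by omega, show i < n + 2 by omega, dite_true]
    exact (cls_eq (Rel.dot_slide_cap n i h)).symm
  · simp [capS, h]

theorem circleS {n i : ℕ} (h : i ≤ n) : cupS K n i ⊚ capS K n i = (2 : K) • idS K n := by
  simp only [capS, cupS, h, dite_true]
  exact (cls_eq (Rel.circle n i h)).trans (map_smul _ _ _)

theorem dotS_dotS (n i : ℕ) : dotS K n i ⊚ dotS K n i = 0 := by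
  by_cases h : i < n
  · simp only [dotS, h, dite_true]
    exact (cls_eq (Rel.two_dots n i h)).trans (map_zero _)
  · simp [dotS, h]

theorem neckS {n i : ℕ} (h : i ≤ n) : dotS K (n + 2) i + dotS K (n + 2) (i + 1) =
    dotS K (n + 2) i ⊚ capS K n i ⊚ cupS K n i + capS K n i ⊚ cupS K n i ⊚ dotS K (n + 2) i := by
  simp only [capS, cupS, dotS, h, show i + 1 < n + 2 by omega, show i < n + 2 by omega, dite_true]
  exact (map_add _ _ _).symm.trans ((cls_eq (Rel.neck n i h)).trans (map_add _ _ _))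

/-- A dotted circle is zero. -/
theorem dotted_circle [CharZero K] (n i : ℕ) :
    cupS K n i ⊚ dotS K (n + 2) i ⊚ capS K n i = 0 := by
  by_cases h : i ≤ n
  -- Closing the neck relation with a cup below and a cap above gives `2 D = 4 D` for the dotted
  -- circle `D`.
  · have e := congrArg (fun z => cupS K n i ⊚ z ⊚ capS K n i) (neckS (K := K) h)
    simp only [map_add, LinearMap.add_apply, cupS_dotS, ← skComp_assoc] at e
    rw [skComp_assoc _ (cupS K n i) (capS K n i), circleS h, LinearMap.map_smul₂,
      LinearMap.map_smul₂, LinearMap.map_smul₂, idS_comp, map_smul, comp_idS, ← two_smul K,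
      ← two_smul K, smul_smul] at e
    have e' := sub_eq_zero.2 e
    rw [← sub_smul] at e'
    exact (smul_eq_zero.1 e').resolve_left (by norm_num)
  · simp [cupS, h]

/-- Any tangle is a composite of elementary ones. -/
theorem skein_induction {b c : ℕ} (t : Tangle b c) {p : ∀ n, Skein K b n → Prop}
    (nil : p b (idS K b)) (cup : ∀ n i x, i ≤ n → p n x → p (n + 2) (x ⊚ cupS K n i))
    (cap : ∀ n i x, i ≤ n → p (n + 2) x → p n (x ⊚ capS K n i))
    (dot : ∀ n i x, i < n → p n x → p n (x ⊚ dotS K n i)) : p c (cls K (tan K t)) := by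
  -- Layers are consumed from the bottom while `p` grows at the top, so the claim is generalized to
  -- an arbitrary tangle class `x` already stacked below.
  suffices H : ∀ {a} (t : Tangle a c) (x : Skein K b a), p a x → p c (x ⊚ cls K (tan K t)) by
    rw [← idS_comp (cls K (tan K t))]
    exact H t _ nil
  clear t nil
  intro a t
  induction t with
  | nil n => intro x hx; exact (comp_idS x).symm ▸ hx
  | cons L t ih =>
    intro x hx
    have e : cls K (tan K (.cons L t)) = cls K (tan K (.of L)) ⊚ cls K (tan K t) := by
      rw [skComp_cls, linComp_tan]; rfl
    rw [e, ← skComp_assoc]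
    refine ih _ ?_
    cases L with
    | cup n i h => have := cup _ i x h hx; rwa [cupS, dif_pos h] at this
    | cap n i h => have := cap _ i x h hx; rwa [capS, dif_pos h] at this
    | dot n i h => have := dot _ i x h hx; rwa [dotS, dif_pos h] at this

/-! ### The alternating sum of the dots is central -/

variable (K) in
/-- The alternating sum of the dots on the strands. -/
def altDot (n : ℕ) : Skein K n n := ∑ i ∈ Finset.range n, (-1 : K) ^ i • dotS K n i

/-- Isolates the two dots at the ends of a cup or cap at `i`: they have opposite signs, and the dots
further right are renumbered by two, which preserves their signs. -/
theorem altDot_add_two {n i : ℕ} (h : i ≤ n) : altDot K (n + 2) =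
    ∑ k ∈ Finset.range i, (-1 : K) ^ k • dotS K (n + 2) k +
      (-1 : K) ^ i • (dotS K (n + 2) i - dotS K (n + 2) (i + 1)) +
      ∑ k ∈ Finset.Ico i n, (-1 : K) ^ k • dotS K (n + 2) (k + 2) := by
  rw [altDot, ← Finset.sum_range_add_sum_Ico _ (show i ≤ n + 2 by omega),
    Finset.sum_eq_sum_Ico_succ_bot (by omega), Finset.sum_eq_sum_Ico_succ_bot (by omega),
    ← Finset.sum_Ico_add' (fun k => (-1 : K) ^ k • dotS K (n + 2) k) i n 2]
  simp only [pow_add, smul_sub]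
  simp
  abel

theorem cupS_altDot {n i : ℕ} (h : i ≤ n) :
    cupS K n i ⊚ altDot K (n + 2) = altDot K n ⊚ cupS K n i := by
  rw [altDot_add_two h, altDot, ← Finset.sum_range_add_sum_Ico _ h]
  simp only [map_add, map_sum, map_smul, map_sub, cupS_dotS, sub_self, smul_zero, add_zero,
    LinearMap.add_apply, LinearMap.sum_apply, LinearMap.smul_apply]
  congr 1
  · exact Finset.sum_congr rfl fun k hk => by rw [cupS_dotS_left (Finset.mem_range.1 hk) h]
  · refine Finset.sum_congr rfl fun k hk => ?_
    rw [cupS_dotS_right (Finset.mem_Ico.1 hk).1 (Finset.mem_Ico.1 hk).2]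

theorem capS_altDot {n i : ℕ} (h : i ≤ n) :
    capS K n i ⊚ altDot K n = altDot K (n + 2) ⊚ capS K n i := by
  rw [altDot_add_two h, altDot, ← Finset.sum_range_add_sum_Ico _ h]
  simp only [map_add, map_sum, map_smul, map_sub, dotS_capS, sub_self, smul_zero, add_zero,
    LinearMap.add_apply, LinearMap.sum_apply, LinearMap.smul_apply, LinearMap.sub_apply]
  congr 1
  · exact Finset.sum_congr rfl fun k hk => by rw [capS_dotS_left (Finset.mem_range.1 hk) h]
  · refine Finset.sum_congr rfl fun k hk => ?_
    rw [capS_dotS_right (Finset.mem_Ico.1 hk).1 (Finset.mem_Ico.1 hk).2]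

theorem dotS_altDot (n i : ℕ) : dotS K n i ⊚ altDot K n = altDot K n ⊚ dotS K n i := by
  simp only [altDot, map_sum, map_smul, LinearMap.sum_apply, LinearMap.smul_apply]
  exact Finset.sum_congr rfl fun k _ => by rw [dotS_comm]

/-- Only cups, caps and dots have to be tested, as they generate all tangles. Centrality is what
makes `altDot` compatible with symmetrizers and with the transition maps of the Kirby system. -/
theorem altDot_central {a b : ℕ} (x : Skein K a b) : x ⊚ altDot K b = altDot K a ⊚ x := by
  obtain ⟨x, rfl⟩ := cls_surjective x
  induction x using tan_induction with
  | zero => simp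
  | add x y hx hy => simp [hx, hy]
  | smul r x hx => simp [hx]
  | of t =>
    refine skein_induction t (p := fun n x => x ⊚ altDot K n = altDot K a ⊚ x) ?_ ?_ ?_ ?_
    · rw [idS_comp, comp_idS]
    · intro n i x h hx
      rw [skComp_assoc, cupS_altDot h, ← skComp_assoc, hx, skComp_assoc]
    · intro n i x h hx
      rw [skComp_assoc, capS_altDot h, ← skComp_assoc, hx, skComp_assoc]
    · intro n i x h hx
      rw [skComp_assoc, dotS_altDot, ← skComp_assoc, hx, skComp_assoc]

end SkeinRelations

section Action

/-! ### A representation on covectors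

A covector on a tensor power of the plane with basis `true`, `false` is regarded as a function of
infinite words in these letters; tangles act on covectors contravariantly. -/

/-- Insertion of the letters `a` and `b` at the places `i` and `i + 1` of an infinite word. -/
def insertPair (i : ℕ) (a b : Bool) (w : ℕ → Bool) (k : ℕ) : Bool :=
  if k < i then w k else if k = i then a else if k = i + 1 then b else w (k - 2)

/-- Deletion of the letters at the places `i` and `i + 1`. -/
def deletePair (i : ℕ) (w : ℕ → Bool) (k : ℕ) : Bool :=
  if k < i then w k else w (k + 2)

/-- Replacement of the letter at the place `i` by `false`. -/
def lower (i : ℕ) (w : ℕ → Bool) (k : ℕ) : Bool := if k = i then false else w k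

variable (K : Type u) [Field K]

/-- The antisymmetric form on the plane. -/
def sgn (a b : Bool) : K := if a = b then 0 else if a then 1 else -1

/-- The pullback of covectors along a cup. -/
def cupAct (i : ℕ) : Module.End K ((ℕ → Bool) → K) where
  toFun ψ w := (-1) ^ i * (ψ (insertPair i true false w) - ψ (insertPair i false true w))
  map_add' ψ ψ' := by ext w; simp only [Pi.add_apply]; ring
  map_smul' r ψ := by ext w; simp only [Pi.smul_apply, smul_eq_mul, RingHom.id_apply]; ring

/-- The pullback of covectors along a cap. -/
def capAct (i : ℕ) : Module.End K ((ℕ → Bool) → K) where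
  toFun ψ w := (-1) ^ i * (sgn K (w i) (w (i + 1)) * ψ (deletePair i w))
  map_add' ψ ψ' := by ext w; simp only [Pi.add_apply]; ring
  map_smul' r ψ := by ext w; simp only [Pi.smul_apply, smul_eq_mul, RingHom.id_apply]; ring

/-- The pullback of covectors along a dot. -/
def dotAct (i : ℕ) : Module.End K ((ℕ → Bool) → K) where
  toFun ψ w := (-1) ^ i * if w i then ψ (lower i w) else 0
  map_add' ψ ψ' := by ext w; simp only [Pi.add_apply]; split_ifs <;> ring
  map_smul' r ψ := by
    ext w; simp only [Pi.smul_apply, smul_eq_mul, RingHom.id_apply]; split_ifs <;> ring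

theorem cupAct_apply (i : ℕ) (ψ : (ℕ → Bool) → K) (w) : cupAct K i ψ w =
    (-1) ^ i * (ψ (insertPair i true false w) - ψ (insertPair i false true w)) := rfl

theorem capAct_apply (i : ℕ) (ψ : (ℕ → Bool) → K) (w) : capAct K i ψ w =
    (-1) ^ i * (sgn K (w i) (w (i + 1)) * ψ (deletePair i w)) := rfl

theorem dotAct_apply (i : ℕ) (ψ : (ℕ → Bool) → K) (w) : dotAct K i ψ w =
    (-1) ^ i * if w i then ψ (lower i w) else 0 := rfl

/-! ### Combinatorics of inserting, deleting and lowering letters -/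

theorem insertPair_insertPair {i j : ℕ} (h : i ≤ j) (a b c d : Bool) (w : ℕ → Bool) :
    insertPair i a b (insertPair j c d w) = insertPair (j + 2) c d (insertPair i a b w) := by
  ext k; grind (splits := 30) [insertPair]

theorem deletePair_deletePair {i j : ℕ} (h : i ≤ j) (w : ℕ → Bool) :
    deletePair j (deletePair i w) = deletePair i (deletePair (j + 2) w) := by
  ext k; grind (splits := 30) [deletePair]

theorem deletePair_insertPair_left {i j : ℕ} (h : i ≤ j) (a b : Bool) (w : ℕ → Bool) :
    deletePair (j + 2) (insertPair i a b w) = insertPair i a b (deletePair j w) := by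
  ext k; grind (splits := 30) [deletePair, insertPair]

theorem deletePair_insertPair_right {i j : ℕ} (h : i ≤ j) (a b : Bool) (w : ℕ → Bool) :
    deletePair i (insertPair (j + 2) a b w) = insertPair j a b (deletePair i w) := by
  ext k; grind (splits := 30) [deletePair, insertPair]

theorem deletePair_insertPair (i : ℕ) (a b : Bool) (w : ℕ → Bool) :
    deletePair i (insertPair i a b w) = w := by
  ext k; grind (splits := 30) [deletePair, insertPair]

/-- The combinatorial form of a zigzag: the inserted `b` and the old letter `w i` are deleted, and
the inserted `a` takes the place of the latter. -/
theorem deletePair_insertPair_succ (i : ℕ) (a b : Bool) (w : ℕ → Bool) (h : a = w i) :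
    deletePair (i + 1) (insertPair i a b w) = w := by
  ext k; grind (splits := 30) [deletePair, insertPair]

theorem deletePair_insertPair_pred (i : ℕ) (a b : Bool) (w : ℕ → Bool) (h : b = w i) :
    deletePair i (insertPair (i + 1) a b w) = w := by
  ext k; grind (splits := 30) [deletePair, insertPair]

/-- Reduces relations that are local at the places `i` and `i + 1` to the four possible pairs of
letters. -/
theorem insertPair_surjective (i : ℕ) (w : ℕ → Bool) : ∃ a b v, w = insertPair i a b v :=
  ⟨w i, w (i + 1), deletePair i w, by
    ext k; grind (splits := 30) [insertPair, deletePair]⟩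

theorem insertPair_lt {i k : ℕ} (h : k < i) (a b : Bool) (w : ℕ → Bool) :
    insertPair i a b w k = w k := by grind [insertPair]

theorem insertPair_self (i : ℕ) (a b : Bool) (w : ℕ → Bool) : insertPair i a b w i = a := by
  grind [insertPair]

theorem insertPair_succ (i : ℕ) (a b : Bool) (w : ℕ → Bool) :
    insertPair i a b w (i + 1) = b := by
  grind [insertPair]

theorem insertPair_ge {i k : ℕ} (h : i ≤ k) (a b : Bool) (w : ℕ → Bool) :
    insertPair i a b w (k + 2) = w k := by grind [insertPair]

theorem deletePair_lt {i k : ℕ} (h : k < i) (w : ℕ → Bool) : deletePair i w k = w k := by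
  grind [deletePair]

theorem deletePair_ge {i k : ℕ} (h : i ≤ k) (w : ℕ → Bool) : deletePair i w k = w (k + 2) := by
  grind [deletePair]

theorem lower_insertPair_lt {i j : ℕ} (h : j < i) (a b : Bool) (w : ℕ → Bool) :
    lower j (insertPair i a b w) = insertPair i a b (lower j w) := by
  ext k; grind (splits := 30) [lower, insertPair]

theorem lower_insertPair_ge {i j : ℕ} (h : i ≤ j) (a b : Bool) (w : ℕ → Bool) :
    lower (j + 2) (insertPair i a b w) = insertPair i a b (lower j w) := by
  ext k; grind (splits := 30) [lower, insertPair]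

theorem lower_insertPair_self (i : ℕ) (a b : Bool) (w : ℕ → Bool) :
    lower i (insertPair i a b w) = insertPair i false b w := by
  ext k; grind (splits := 30) [lower, insertPair]

theorem lower_insertPair_succ (i : ℕ) (a b : Bool) (w : ℕ → Bool) :
    lower (i + 1) (insertPair i a b w) = insertPair i a false w := by
  ext k; grind (splits := 30) [lower, insertPair]

theorem lower_deletePair_lt {i j : ℕ} (h : j < i) (w : ℕ → Bool) :
    lower j (deletePair i w) = deletePair i (lower j w) := by
  ext k; grind (splits := 30) [lower, deletePair]

theorem lower_deletePair_ge {i j : ℕ} (h : i ≤ j) (w : ℕ → Bool) :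
    lower j (deletePair i w) = deletePair i (lower (j + 2) w) := by
  ext k; grind (splits := 30) [lower, deletePair]

theorem lower_self (i : ℕ) (w : ℕ → Bool) : lower i w i = false := by simp [lower]

theorem lower_of_ne {i k : ℕ} (h : k ≠ i) (w : ℕ → Bool) : lower i w k = w k := by simp [lower, h]

theorem lower_comm (i j : ℕ) (w : ℕ → Bool) : lower i (lower j w) = lower j (lower i w) := by
  ext k; grind [lower]

/-! ### The action of tangles, and its compatibility with the relations -/

/-- The pullback of covectors along an elementary tangle. -/
def layerAct : {a b : ℕ} → Layer a b → Module.End K ((ℕ → Bool) → K)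
  | _, _, .cup _ i _ => cupAct K i
  | _, _, .cap _ i _ => capAct K i
  | _, _, .dot _ i _ => dotAct K i

/-- The pullback of covectors along a tangle. -/
def tangleAct : {a b : ℕ} → Tangle a b → Module.End K ((ℕ → Bool) → K)
  | _, _, .nil _ => 1
  | _, _, .cons L t => layerAct K L * tangleAct t

theorem tangleAct_append {a b c : ℕ} (s : Tangle a b) (t : Tangle b c) :
    tangleAct K (s.append t) = tangleAct K s * tangleAct K t := by
  induction s with
  | nil => simp [Tangle.append, tangleAct]
  | cons L s ih => simp [Tangle.append, tangleAct, ih, mul_assoc]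

/-- The pullback of covectors along a linear combination of tangles. -/
def linAct {a b : ℕ} : Lin K a b →ₗ[K] Module.End K ((ℕ → Bool) → K) :=
  Finsupp.linearCombination K (tangleAct K)

variable {K}

theorem linAct_tan {a b : ℕ} (t : Tangle a b) : linAct K (tan K t) = tangleAct K t := by
  simp [linAct, tan]

theorem linAct_comp {a b c : ℕ} (x : Lin K a b) (y : Lin K b c) :
    linAct K (x ⊡ y) = linAct K x * linAct K y := by
  induction x using tan_induction with
  | zero => simp
  | add x x' h h' => simp [h, h', add_mul]
  | smul r x h => simp [h]
  | of s =>
    induction y using tan_induction with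
    | zero => simp
    | add x x' h h' => simp [h, h', mul_add]
    | smul r x h => simp [h]
    | of t => rw [linComp_tan, linAct_tan, linAct_tan, linAct_tan, tangleAct_append]

theorem linAct_cupL (n i : ℕ) (h : i ≤ n) : linAct K (cupL K n i h) = cupAct K i := by
  rw [cupL, linAct_tan]; exact mul_one _

theorem linAct_capL (n i : ℕ) (h : i ≤ n) : linAct K (capL K n i h) = capAct K i := by
  rw [capL, linAct_tan]; exact mul_one _

theorem linAct_dotL (n i : ℕ) (h : i < n) : linAct K (dotL K n i h) = dotAct K i := by
  rw [dotL, linAct_tan]; exact mul_one _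

theorem linAct_idL (n : ℕ) : linAct K (idL K n) = 1 := by
  rw [idL, linAct_tan]; rfl

theorem neg_one_pow_sq (i : ℕ) : ((-1 : K) ^ i) * (-1) ^ i = 1 := by
  rw [← mul_pow]; simp

/-- The signs `(-1) ^ i` turn the antisymmetric form into a symmetric duality. Without them a zigzag
would straighten to minus the identity, and a dot would change sign when sliding over a cup or a
cap; in both cases the two places involved differ by one, which supplies the missing sign. A circle
uses the same place twice and keeps the value `2`. -/
theorem linAct_rel {a b : ℕ} {x y : Lin K a b} (h : Rel K x y) : linAct K x = linAct K y := by
  induction h <;> refine LinearMap.ext fun ψ => funext fun w => ?_ <;>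
    simp only [linAct_comp, linAct_cupL, linAct_capL, linAct_dotL, linAct_idL, map_add, map_smul,
      map_zero, Module.End.mul_apply, Module.End.one_apply, LinearMap.add_apply,
      LinearMap.smul_apply, Pi.add_apply, Pi.smul_apply, LinearMap.zero_apply, Pi.zero_apply,
      cupAct_apply, capAct_apply, dotAct_apply]
  case cup_cup n i j hij hj =>
    simp only [insertPair_insertPair hij, pow_add]
    ring
  case cap_cap n i j hij hj =>
    rw [deletePair_deletePair hij, deletePair_ge hij, deletePair_ge (by omega),
      deletePair_lt (by omega), deletePair_lt (by omega), pow_add]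
    ring
  case cap_cup_left n i j hij hj =>
    simp only [insertPair_ge hij, show j + 2 + 1 = j + 1 + 2 by ring,
      insertPair_ge (show i ≤ j + 1 by omega), deletePair_insertPair_left hij, pow_add]
    ring
  case cap_cup_right n i j hij hj =>
    simp only [insertPair_lt (show i < j + 2 by omega), insertPair_lt (show i + 1 < j + 2 by omega),
      deletePair_insertPair_right hij, pow_add]
    ring
  case dot_dot n i j hi hj =>
    rcases eq_or_ne i j with rfl | h
    · rfl
    rw [lower_of_ne h, lower_of_ne h.symm, lower_comm]
    split_ifs <;> ring
  case dot_cup_left n i j hij hi =>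
    simp only [insertPair_lt hij, lower_insertPair_lt hij]
    split_ifs <;> ring
  case dot_cup_right n i j hij hj =>
    simp only [insertPair_ge hij, lower_insertPair_ge hij, pow_add]
    split_ifs <;> ring
  case dot_cap_left n i j hij hi =>
    rw [deletePair_lt hij, lower_deletePair_lt hij, lower_of_ne (by omega), lower_of_ne (by omega)]
    split_ifs <;> ring
  case dot_cap_right n i j hij hj =>
    rw [deletePair_ge hij, lower_deletePair_ge hij, lower_of_ne (by omega), lower_of_ne (by omega)]
    split_ifs <;> ring
  case zigzag_right n i h =>
    have := neg_one_pow_sq (K := K) i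
    simp only [insertPair_succ, insertPair_ge le_rfl, pow_succ, show i + 1 + 1 = i + 2 by ring]
    -- The letter `w i` decides which of the two insertions pairs nontrivially under the form.
    cases hw : w i
    · rw [deletePair_insertPair_succ i false true w hw.symm]
      simp [sgn]
      linear_combination ψ w * this
    · rw [deletePair_insertPair_succ i true false w hw.symm]
      simp [sgn]
      linear_combination ψ w * this
  case zigzag_left n i h =>
    have := neg_one_pow_sq (K := K) i
    simp only [insertPair_self, insertPair_lt (Nat.lt_succ_self i), pow_succ]
    cases hw : w i
    · rw [deletePair_insertPair_pred i true false w hw.symm]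
      simp [sgn]
      linear_combination ψ w * this
    · rw [deletePair_insertPair_pred i false true w hw.symm]
      simp [sgn]
      linear_combination ψ w * this
  case dot_slide_cup n i h =>
    simp only [insertPair_self, insertPair_succ, lower_insertPair_self, lower_insertPair_succ]
    simp
    ring
  case dot_slide_cap n i h =>
    obtain ⟨a, b, v, rfl⟩ := insertPair_surjective i w
    simp only [insertPair_self, insertPair_succ, lower_insertPair_self, lower_insertPair_succ,
      deletePair_insertPair]
    cases a <;> cases b <;> simp [sgn] <;> ring
  case circle n i h =>
    simp only [insertPair_self, insertPair_succ, deletePair_insertPair]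
    have := neg_one_pow_sq (K := K) i
    simp [sgn]
    linear_combination (2 * ψ w) * this
  case two_dots n i h => simp [lower_self]
  case neck n i h =>
    obtain ⟨a, b, v, rfl⟩ := insertPair_surjective i w
    simp only [insertPair_self, insertPair_succ, lower_insertPair_self, lower_insertPair_succ,
      deletePair_insertPair]
    have := neg_one_pow_sq (K := K) i
    cases a <;> cases b <;> simp [sgn, pow_succ]
    · linear_combination -ψ (insertPair i false false v) * this
    · linear_combination -ψ (insertPair i false false v) * this
    · linear_combination (-1) ^ i * (ψ (insertPair i true false v) -
        ψ (insertPair i false true v)) * this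

/-- The pullback of covectors along a class of tangles. -/
def skAct {a b : ℕ} : Skein K a b →ₗ[K] Module.End K ((ℕ → Bool) → K) :=
  (relIdeal K a b).liftQ (linAct K) (by
    rw [relIdeal, Submodule.span_le]
    rintro _ ⟨c, d, s, x, y, t, h, rfl⟩
    simp [linAct_comp, linAct_rel h])

theorem skAct_cls {a b : ℕ} (x : Lin K a b) : skAct (cls K x) = linAct K x := rfl

theorem skAct_skComp {a b c : ℕ} (x : Skein K a b) (y : Skein K b c) :
    skAct (skComp K x y) = skAct x * skAct y := by
  obtain ⟨x, rfl⟩ := cls_surjective x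
  obtain ⟨y, rfl⟩ := cls_surjective y
  exact linAct_comp x y

/-! ### Symmetric covectors -/

/-- The number of letters `true` among the first `n` letters. -/
def countTrue (n : ℕ) (w : ℕ → Bool) : ℕ := ∑ k ∈ Finset.range n, (w k).toNat

theorem countTrue_insertPair {n i : ℕ} (h : i ≤ n) (a b : Bool) (w : ℕ → Bool) :
    countTrue (n + 2) (insertPair i a b w) = countTrue n w + a.toNat + b.toNat := by
  obtain ⟨l, rfl⟩ := Nat.exists_eq_add_of_le h
  induction l with
  | zero =>
    simp only [countTrue, add_zero, Finset.sum_range_succ, insertPair_self, insertPair_succ]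
    congr 2
    exact Finset.sum_congr rfl fun k hk => by rw [insertPair_lt (Finset.mem_range.1 hk)]
  | succ l ih =>
    have := ih (by omega)
    rw [countTrue] at this ⊢
    rw [show i + (l + 1) + 2 = i + l + 2 + 1 by ring, Finset.sum_range_succ, this,
      insertPair_ge (by omega)]
    rw [countTrue, countTrue, ← add_assoc, Finset.sum_range_succ]
    ring

theorem countTrue_lower {n i : ℕ} (h : i < n) {w : ℕ → Bool} (hw : w i = true) :
    countTrue n (lower i w) + 1 = countTrue n w := by
  rw [countTrue, countTrue, ← Finset.add_sum_erase _ _ (Finset.mem_range.2 h),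
    ← Finset.add_sum_erase _ (fun k => (w k).toNat) (Finset.mem_range.2 h), lower_self, hw,
    Finset.sum_congr rfl fun k hk => by rw [lower_of_ne (Finset.ne_of_mem_erase hk)]]
  simp [add_comm]

/-- The symmetric covector on the `n`-th tensor power whose value at a word is a given function of
the number of letters `true`. -/
def symCov (g : ℕ → K) (n : ℕ) (w : ℕ → Bool) : K := g (countTrue n w)

theorem symCov_top {R : Type*} (g : ℕ → R) (n : ℕ) : symCov g n (fun _ => true) = g n := by
  simp [symCov, countTrue]

/-- Both insertions add exactly one `true`, so a symmetric covector takes the same value on them and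
the antisymmetric form kills it. -/
theorem cupAct_symCov (g : ℕ → K) {n i : ℕ} (h : i ≤ n) : cupAct K i (symCov g (n + 2)) = 0 := by
  ext w
  simp [cupAct_apply, symCov, countTrue_insertPair h]

/-- Only the insertion `true, false` survives the dot, which lowers it to `false, false`; the number
of letters `true` stays that of the original word. This makes a fixed `g` compatible along the Kirby
system. -/
theorem cupAct_dotAct_symCov (g : ℕ → K) (n : ℕ) :
    cupAct K n (dotAct K n (symCov g (n + 2))) = symCov g n := by
  ext w
  rw [cupAct_apply, dotAct_apply, dotAct_apply, lower_insertPair_self, lower_insertPair_self]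
  simp only [insertPair_self, symCov, countTrue_insertPair le_rfl]
  simp [← mul_assoc, neg_one_pow_sq]

/-- The coefficients cancel the signs in `dotAct`, so each letter `true` is lowered in turn, with
the same result. The truncated `k - 1` is harmless at `k = 0` because of the factor `k`. -/
theorem sum_dotAct_symCov (g : ℕ → K) (n : ℕ) :
    ∑ i ∈ Finset.range n, (-1 : K) ^ i • dotAct K i (symCov g n) =
      symCov (fun k => k * g (k - 1)) n := by
  ext w
  simp only [Finset.sum_apply, Pi.smul_apply, smul_eq_mul, dotAct_apply, ← mul_assoc,
    neg_one_pow_sq, one_mul]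
  have : ∀ i ∈ Finset.range n, (if w i then symCov g n (lower i w) else 0) =
      ((w i).toNat : K) * g (countTrue n w - 1) := fun i hi => by
    split_ifs with h
    · rw [symCov, ← countTrue_lower (Finset.mem_range.1 hi) h, h]; simp
    · simp [h]
  rw [Finset.sum_congr rfl this, ← Finset.sum_mul, symCov, countTrue]
  push_cast
  rfl

end Action

section Spanning

/-! ### Morphisms between symmetric powers -/

variable (K : Type u) [Field K]

local infixl:70 " ⊚ " => skComp _

/-- The class of the symmetrizer. -/
def symS (n : ℕ) : Skein K n n := (show skDeg K n n 0 from symm K n).1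

/-- The class of a dotted cup to the right of `n` strands. -/
def dcupS (n : ℕ) : Skein K n (n + 2) := cupS K n n ⊚ dotS K (n + 2) n

variable {K}

/-! ### Absorption by the symmetrizer, and moves of the dotted cup -/

theorem crossing_mul_symm {n i : ℕ} (hi : i + 1 < n) : crossing K n i * symm K n = symm K n := by
  rw [symm, mul_smul_comm, Finset.mul_sum, ← (coxeter_crossing K n).lift_adj i hi]
  congr 1
  refine Fintype.sum_equiv (Equiv.mulLeft (Coxeter.adj n i)) _ _ fun w => ?_
  exact ((permAct K n).map_mul _ _).symm

theorem symm_mul_crossing {n i : ℕ} (hi : i + 1 < n) : symm K n * crossing K n i = symm K n := by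
  rw [symm, smul_mul_assoc, Finset.sum_mul, ← (coxeter_crossing K n).lift_adj i hi]
  congr 1
  refine Fintype.sum_equiv (Equiv.mulRight (Coxeter.adj n i)) _ _ fun w => ?_
  exact ((permAct K n).map_mul _ _).symm

theorem tb_mul_symm {n i : ℕ} (hi : i ≤ n) : tb K n i hi * symm K (n + 2) = 0 := by
  have := crossing_mul_symm (K := K) (show i + 1 < n + 2 by omega)
  rw [crossing, dif_pos hi, sub_mul, one_mul] at this
  exact sub_eq_self.1 this

theorem symm_mul_tb {n i : ℕ} (hi : i ≤ n) : symm K (n + 2) * tb K n i hi = 0 := by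
  have := symm_mul_crossing (K := K) (show i + 1 < n + 2 by omega)
  rw [crossing, dif_pos hi, mul_sub, mul_one] at this
  exact sub_eq_self.1 this

/-- The symmetrizer absorbs the crossing `1 - turnback`, hence kills the turnback; a further cap on
top turns the turnback into twice the cap. -/
theorem symS_capS [CharZero K] (n i : ℕ) : symS K (n + 2) ⊚ capS K n i = 0 := by
  by_cases h : i ≤ n
  · have e : symS K (n + 2) ⊚ (capS K n i ⊚ cupS K n i) = 0 := by
      have := congrArg (fun f : (dTL K).End₀ (gen K (n + 2)) =>
        (show skDeg K (n + 2) (n + 2) 0 from f).1) (tb_mul_symm (K := K) h)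
      rw [capS, cupS, dif_pos h, dif_pos h]
      exact this
    have e' := congrArg (fun z => z ⊚ capS K n i) e
    simp only [skComp_assoc, circleS h, map_smul, comp_idS, map_zero, LinearMap.zero_apply] at e'
    exact (smul_eq_zero.1 e').resolve_left two_ne_zero
  · simp [capS, h]

theorem cupS_symS [CharZero K] (n i : ℕ) : cupS K n i ⊚ symS K (n + 2) = 0 := by
  by_cases h : i ≤ n
  · have e : capS K n i ⊚ cupS K n i ⊚ symS K (n + 2) = 0 := by
      have := congrArg (fun f : (dTL K).End₀ (gen K (n + 2)) =>
        (show skDeg K (n + 2) (n + 2) 0 from f).1) (symm_mul_tb (K := K) h)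
      rw [capS, cupS, dif_pos h, dif_pos h]
      exact this
    have e' := congrArg (fun z => cupS K n i ⊚ z) e
    simp only [← skComp_assoc, circleS h, map_smul, idS_comp, map_zero, LinearMap.smul_apply] at e'
    exact (smul_eq_zero.1 e').resolve_left two_ne_zero
  · simp [cupS, h]

theorem dcupS_capS_left {n i : ℕ} (h : i ≤ n) :
    dcupS K (n + 2) ⊚ capS K (n + 2) i = capS K n i ⊚ dcupS K n := by
  have e := capS_dotS_right (K := K) (show i ≤ n by omega) (show n < n + 2 by omega)
  rw [dcupS, dcupS, skComp_assoc, ← e, ← skComp_assoc, cupS_capS_right h le_rfl, skComp_assoc]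

theorem cupS_dcupS {n i : ℕ} (h : i ≤ n) :
    cupS K n i ⊚ dcupS K (n + 2) = dcupS K n ⊚ cupS K (n + 2) i := by
  rw [dcupS, dcupS, ← skComp_assoc, ← cupS_cupS h le_rfl, skComp_assoc,
    cupS_dotS_right h (show n < n + 2 by omega), skComp_assoc]

/-- With the dot slid to the outer end of the cup, away from the cap, the zigzag straightens. Read
backwards, this creates a dot on the last strand from a dotted cup and a cap. -/
theorem dcupS_capS (n : ℕ) : dcupS K (n + 1) ⊚ capS K (n + 1) n = dotS K (n + 1) n := by
  have e := capS_dotS_right (K := K) (le_refl n) (show n < n + 1 by omega)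
  have e' : dcupS K (n + 1) = cupS K (n + 1) (n + 1) ⊚ dotS K (n + 1 + 2) (n + 2) :=
    (cupS_dotS (n + 1) (n + 1)).symm
  rw [e', skComp_assoc, ← e, ← skComp_assoc, zigzag_left (Nat.lt_succ_self n), idS_comp]

theorem dcupS_capS_self [CharZero K] (n : ℕ) : dcupS K n ⊚ capS K n n = 0 := dotted_circle n n

theorem dcupS_dotS (n : ℕ) : dcupS K n ⊚ dotS K (n + 2) (n + 1) = 0 := by
  rw [dcupS, ← cupS_dotS, skComp_assoc, dotS_dotS, map_zero]

/-! ### Normal forms on top of a symmetrizer -/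

variable (K) in
/-- The symmetrizer of `m` strands, with `a` dotted cups added to the right. -/
def symCups (m : ℕ) : ℕ → (n : ℕ) → Skein K m n
  | 0, n => if h : m = n then h ▸ symS K m else 0
  | a + 1, n + 2 => symCups m a n ⊚ dcupS K n
  | _ + 1, 0 => 0
  | _ + 1, 1 => 0

variable (K) in
/-- The symmetrizer of `m` strands with `a` dotted cups added to the right, and `r` nested caps that
join the former with the latter. -/
def symCupCaps (m a : ℕ) : ℕ → (n : ℕ) → Skein K m n
  | 0, n => symCups K m a n
  | r + 1, n => if r + 1 ≤ m then symCupCaps m a r (n + 2) ⊚ capS K n (m - (r + 1)) else 0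

/-- A cap inside the symmetrizer kills it, a cap closing up one dotted cup gives a dotted circle,
and a cap joining two neighbouring dotted cups puts two dots on one strand. The only other cap, at
`m - 1`, joins the symmetrizer to the first dotted cup. -/
theorem symCups_capS [CharZero K] {m n i : ℕ} (a : ℕ) (h : i + 1 ≠ m) :
    symCups K m a (n + 2) ⊚ capS K n i = 0 := by
  induction a generalizing n with
  | zero =>
    rw [symCups]
    split_ifs with e
    · subst e
      exact symS_capS n i
    · simp
  | succ a ih =>
    by_cases hi : i ≤ n
    · rw [symCups, skComp_assoc]
      obtain rfl | hn := hi.eq_or_lt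
      · rw [dcupS_capS_self, map_zero]
      -- For `i + 1 = n` the cap joins the last dotted cup to the strand before it, which amounts to
      -- a dot on that strand; with another dotted cup there, this is a second dot.
      obtain rfl | hn' := (Nat.succ_le_of_lt hn).eq_or_lt
      · rw [Nat.succ_eq_add_one, dcupS_capS]
        match a, i with
        | 0, i => rw [symCups, dif_neg (Ne.symm h), map_zero, LinearMap.zero_apply]
        | a + 1, 0 => rw [symCups, map_zero, LinearMap.zero_apply]
        | a + 1, i + 1 => rw [symCups, skComp_assoc, dcupS_dotS, map_zero]
      · obtain ⟨n, rfl⟩ : ∃ k, n = k + 2 := ⟨n - 2, by omega⟩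
        rw [dcupS_capS_left (by omega), ← skComp_assoc, ih, map_zero, LinearMap.zero_apply]
    · simp [capS, hi]

/-- A cap that does not enlarge the nest at its outer side can be moved below the caps of the nest
one by one, until it meets a bare `symCups` at a place where it vanishes. -/
theorem symCupCaps_capS [CharZero K] {m n i : ℕ} (a r : ℕ) (h : i + r + 1 ≠ m) :
    symCupCaps K m a r (n + 2) ⊚ capS K n i = 0 := by
  induction r generalizing n i with
  | zero => exact symCups_capS a h
  | succ r ih =>
    rw [symCupCaps]
    split_ifs with hr
    · by_cases hi : i ≤ n
      · by_cases hm : m - (r + 1) ≤ n + 2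
        · rw [skComp_assoc]
          rcases Nat.lt_or_ge i (m - (r + 1)) with hlt | hge
          -- The excluded case `i + 1 = m - (r + 1)` is the one where the two caps would be nested;
          -- otherwise they are disjoint, which gives the gap of two.
          · obtain ⟨j, hj⟩ : ∃ j, m - (r + 1) = j + 2 := ⟨m - (r + 1) - 2, by omega⟩
            rw [hj, ← capS_capS (by omega) (by omega), ← skComp_assoc, ih (by omega), map_zero,
              LinearMap.zero_apply]
          · rw [capS_capS hge hi, ← skComp_assoc, ih (by omega), map_zero, LinearMap.zero_apply]
        · simp [capS, hm]
      · simp [capS, hi]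
    · simp

theorem symCups_eq_zero {m a n : ℕ} (h : m + 2 * a ≠ n) : symCups K m a n = 0 := by
  induction a generalizing n with
  | zero => rw [symCups, dif_neg (by omega)]
  | succ a ih =>
    match n with
    | 0 => rfl
    | 1 => rfl
    | n + 2 => rw [symCups, ih (by omega), map_zero, LinearMap.zero_apply]

theorem symCupCaps_eq_zero {m a r n : ℕ} (h : m + 2 * a ≠ n + 2 * r ∨ m < r) :
    symCupCaps K m a r n = 0 := by
  induction r generalizing n with
  | zero => exact symCups_eq_zero (by omega)
  | succ r ih =>
    rw [symCupCaps]
    split_ifs with hr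
    · rw [ih (by omega), map_zero, LinearMap.zero_apply]
    · rfl

variable (K) in
/-- The span of the tangles `symCupCaps m a r` followed by undotted cups. -/
inductive CupSpan (m a : ℕ) : (n : ℕ) → Skein K m n → Prop
  | zero (n) : CupSpan m a n 0
  | add {n} (x y) : CupSpan m a n x → CupSpan m a n y → CupSpan m a n (x + y)
  | smul {n} (c : K) (x) : CupSpan m a n x → CupSpan m a n (c • x)
  | base (r n) : CupSpan m a n (symCupCaps K m a r n)
  | cup {n i} (x) : i ≤ n → CupSpan m a n x → CupSpan m a (n + 2) (x ⊚ cupS K n i)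

namespace CupSpan

variable {m a : ℕ}

/-- Against an undotted cup, a cap straightens a zigzag, closes a circle or commutes; on a normal
form it becomes the next cap of the nest or gives zero. No dot is used, so `a` is unchanged. -/
theorem cap [CharZero K] {N : ℕ} {x : Skein K m N} (hx : CupSpan K m a N x) :
    ∀ {n i : ℕ} (h : N = n + 2), i ≤ n →
      CupSpan K m a n ((h ▸ x : Skein K m (n + 2)) ⊚ capS K n i) := by
  induction hx with
  | zero => rintro n i rfl -; simpa using zero n
  | add x y _ _ hx hy =>
    rintro n i rfl hi
    simp only [map_add, LinearMap.add_apply]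
    exact add _ _ (hx rfl hi) (hy rfl hi)
  | smul c x _ hx =>
    rintro n i rfl hi
    simp only [map_smul, LinearMap.smul_apply]
    exact smul _ _ (hx rfl hi)
  | base r N =>
    rintro n i rfl hi
    by_cases h : i + r + 1 = m
    · have := base (K := K) (m := m) (a := a) (r + 1) n
      rwa [symCupCaps, if_pos (by omega), show m - (r + 1) = i by omega] at this
    · dsimp only
      rw [symCupCaps_capS a r h]
      exact zero n
  | @cup N j x hj hx' hx =>
    intro n i h hi
    obtain rfl : N = n := by omega
    dsimp only
    rw [skComp_assoc]
    rcases lt_trichotomy i j with hij | rfl | hij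
    · obtain rfl | hij' := (Nat.succ_le_of_lt hij).eq_or_lt
      · rw [Nat.succ_eq_add_one, zigzag_left (by omega), comp_idS]
        exact hx'
      · obtain ⟨j, rfl⟩ : ∃ k, j = k + 2 := ⟨j - 2, by omega⟩
        obtain ⟨N, rfl⟩ : ∃ k, N = k + 2 := ⟨N - 2, by omega⟩
        rw [cupS_capS_right (by omega) (by omega), ← skComp_assoc]
        exact cup _ (by omega) (hx rfl (by omega))
    · rw [circleS hj, map_smul, comp_idS]
      exact smul _ _ hx'
    · obtain rfl | hij' := (Nat.succ_le_of_lt hij).eq_or_lt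
      · rw [Nat.succ_eq_add_one, zigzag_right (by omega), comp_idS]
        exact hx'
      · obtain ⟨i, rfl⟩ : ∃ k, i = k + 2 := ⟨i - 2, by omega⟩
        obtain ⟨N, rfl⟩ : ∃ k, N = k + 2 := ⟨N - 2, by omega⟩
        rw [cupS_capS_left (by omega) (by omega), ← skComp_assoc]
        exact cup _ (by omega) (hx rfl (by omega))

theorem base_dcup (r n : ℕ) : CupSpan K m (a + 1) (n + 2) (symCupCaps K m a r n ⊚ dcupS K n) := by
  -- The alternative `0` is needed: a cap that is out of range on the left, hence zero by default,
  -- may be within range in the wider `symCupCaps K m (a + 1) r (n + 2)`.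
  have key : symCupCaps K m a r n ⊚ dcupS K n = 0 ∨
      symCupCaps K m a r n ⊚ dcupS K n = symCupCaps K m (a + 1) r (n + 2) := by
    induction r generalizing n with
    | zero => exact Or.inr rfl
    | succ r ih =>
      rw [symCupCaps, symCupCaps]
      split_ifs with hr
      · by_cases hi : m - (r + 1) ≤ n
        · rw [skComp_assoc, ← dcupS_capS_left hi, ← skComp_assoc]
          rcases ih (n + 2) with h | h
          · exact Or.inl (by rw [h, map_zero, LinearMap.zero_apply])
          · exact Or.inr (by rw [h])
        · exact Or.inl (by simp [capS, hi])
      · exact Or.inl (by simp)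
  rcases key with h | h <;> rw [h]
  · exact zero _
  · exact base _ _

theorem dcup {n : ℕ} {x : Skein K m n} (hx : CupSpan K m a n x) :
    CupSpan K m (a + 1) (n + 2) (x ⊚ dcupS K n) := by
  induction hx with
  | zero => simpa using zero _
  | add x y _ _ hx hy => simpa using add _ _ hx hy
  | smul c x _ hx => simpa using smul c _ hx
  | base r n => exact base_dcup r n
  | cup x hi _ hx =>
    rw [skComp_assoc, cupS_dcupS hi, ← skComp_assoc]
    exact cup _ (by omega) hx

/-- On the last strand a dot is a dotted cup followed by a cap, and both are already known to
preserve the spans. The neck relation moves a dot from strand `i` to strand `i + 1` at the cost of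
turnbacks, which also preserve them. -/
theorem dot [CharZero K] {n : ℕ} {x : Skein K m n} (hx : CupSpan K m a n x) (i : ℕ) :
    CupSpan K m (a + 1) n (x ⊚ dotS K n i) := by
  -- Here `l` is the number of strands to the right of `i`. The claim is needed for all `x`, since
  -- one term of the neck relation has the dot above `x` followed by a turnback.
  have H : ∀ l i : ℕ, i + l + 1 = n → ∀ x : Skein K m n, CupSpan K m a n x →
      CupSpan K m (a + 1) n (x ⊚ dotS K n i) := by
    clear hx
    intro l
    induction l with
    | zero =>
      intro i hi x hx
      obtain rfl : i + 1 = n := hi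
      have := cap hx.dcup rfl (show i ≤ i + 1 by omega)
      dsimp only at this
      rwa [skComp_assoc, dcupS_capS] at this
    | succ l ih =>
      intro i hi x hx
      obtain ⟨n, rfl⟩ : ∃ k, n = k + 2 := ⟨n - 2, by omega⟩
      have h₁ := ih (i + 1) (by omega) x hx
      have hi' : i ≤ n := by omega
      have h₂ := ih (i + 1) (by omega) _ (cup _ hi' (cap hx rfl hi'))
      have h₃ := cup _ hi' (cap h₁ rfl hi')
      have e : x ⊚ dotS K (n + 2) i = (-1 : K) • (x ⊚ dotS K (n + 2) (i + 1)) +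
          (x ⊚ dotS K (n + 2) (i + 1) ⊚ capS K n i ⊚ cupS K n i +
            x ⊚ capS K n i ⊚ cupS K n i ⊚ dotS K (n + 2) (i + 1)) := by
        have := congrArg (fun z => x ⊚ z) (neckS (K := K) (show i ≤ n by omega))
        simp only [map_add, ← skComp_assoc] at this
        rw [neg_one_smul, ← sub_eq_neg_add, eq_sub_iff_add_eq, this]
        simp only [skComp_assoc, cupS_dotS, dotS_capS]
      rw [e]
      exact add _ _ (smul _ _ h₁) (add _ _ h₃ h₂)
  by_cases hi : i < n
  · exact H (n - i - 1) i (by omega) x hx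
  · simpa [dotS, hi] using zero n

end CupSpan

/-! ### Bounds for the morphism spaces between symmetrizers -/

theorem symS_tangle_mem [CharZero K] {m n : ℕ} (t : Tangle m n) :
    CupSpan K m t.dots n (symS K m ⊚ cls K (tan K t)) := by
  -- Layers are stacked one at a time on an element of the span, starting from the normal form `symS
  -- K m` without dotted cups or caps; only dots raise `a`.
  suffices H : ∀ {b c : ℕ} (t : Tangle b c) (a : ℕ) (x : Skein K m b), CupSpan K m a b x →
      CupSpan K m (a + t.dots) c (x ⊚ cls K (tan K t)) by
    rw [← zero_add t.dots]
    refine H t 0 _ ?_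
    have := CupSpan.base (K := K) (m := m) (a := 0) 0 m
    rwa [symCupCaps, symCups, dif_pos rfl] at this
  clear t
  intro b c t
  induction t with
  | nil n => intro a x hx; exact (comp_idS x).symm ▸ hx
  | cons L t ih =>
    intro a x hx
    have e : cls K (tan K (.cons L t)) = cls K (tan K (.of L)) ⊚ cls K (tan K t) := by
      rw [skComp_cls, linComp_tan]; rfl
    rw [e, ← skComp_assoc]
    cases L with
    | cup _ i h =>
      have := ih a _ (CupSpan.cup _ h hx)
      rwa [cupS, dif_pos h] at this
    | cap _ i h =>
      have := ih a _ (hx.cap rfl h)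
      rwa [capS, dif_pos h] at this
    | dot _ i h =>
      have := ih (a + 1) _ (hx.dot i)
      rwa [dotS, dif_pos h, add_assoc, add_comm 1] at this

/-- The upper symmetrizer kills everything that ends in an undotted cup, and among the normal forms
the strand count leaves only the one with `r` caps. -/
theorem CupSpan.exists_smul [CharZero K] {m a n r : ℕ} (h : m + 2 * a = n + 2 * r)
    {x : Skein K m n} (hx : CupSpan K m a n x) :
    ∃ c : K, x ⊚ symS K n = c • (symCupCaps K m a r n ⊚ symS K n) := by
  induction hx with
  | zero => exact ⟨0, by simp⟩
  | add x y _ _ hx hy =>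
    obtain ⟨c, hc⟩ := hx h
    obtain ⟨d, hd⟩ := hy h
    exact ⟨c + d, by simp [hc, hd, add_smul]⟩
  | smul c x _ hx =>
    obtain ⟨d, hd⟩ := hx h
    exact ⟨c * d, by simp [hd, mul_smul]⟩
  | base s n =>
    rcases eq_or_ne s r with rfl | hs
    · exact ⟨1, (one_smul _ _).symm⟩
    · exact ⟨0, by rw [symCupCaps_eq_zero (by omega)]; simp⟩
  | cup x hi _ _ => exact ⟨0, by rw [skComp_assoc, cupS_symS]; simp⟩

theorem CupSpan.comp_symS_eq_zero [CharZero K] {m a n : ℕ} (h : ∀ r ≤ m, m + 2 * a ≠ n + 2 * r)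
    {x : Skein K m n} (hx : CupSpan K m a n x) : x ⊚ symS K n = 0 := by
  induction hx with
  | zero => simp
  | add x y _ _ hx hy => simp [hx h, hy h]
  | smul c x _ hx => simp [hx h]
  | base s n =>
    rw [symCupCaps_eq_zero, map_zero, LinearMap.zero_apply]
    by_contra! H
    exact h s H.2 H.1
  | cup x hi _ _ => rw [skComp_assoc, cupS_symS, map_zero]

theorem symS_symS [CharZero K] (n : ℕ) : symS K n ⊚ symS K n = symS K n :=
  congrArg (fun f : (dTL K).End₀ (gen K n) => (show skDeg K n n 0 from f).1) (symm_idem K n)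

/-- The space of morphisms of a given degree between symmetric powers is at most
one-dimensional. -/
theorem symS_comp_symS_eq_smul [CharZero K] {m n a r : ℕ} (h : m + 2 * a = n + 2 * r)
    {x : Skein K m n} (hx : x ∈ skDeg K m n (2 * a)) : ∃ c : K,
    symS K m ⊚ x ⊚ symS K n = c • (symCupCaps K m a r n ⊚ symS K n) := by
  induction hx using Submodule.span_induction with
  | zero => exact ⟨0, by simp⟩
  | add x y _ _ hx hy =>
    obtain ⟨c, hc⟩ := hx
    obtain ⟨d, hd⟩ := hy
    exact ⟨c + d, by simp [hc, hd, add_smul]⟩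
  | smul c x _ hx =>
    obtain ⟨d, hd⟩ := hx
    exact ⟨c * d, by simp [hd, mul_smul]⟩
  | mem x hx =>
    obtain ⟨t, ht, rfl⟩ := hx
    obtain rfl : t.dots = a := by simpa [Tangle.deg] using ht
    exact (symS_tangle_mem t).exists_smul h

theorem symS_comp_symS_eq_zero [CharZero K] {m n : ℕ} {d : ℤ}
    (h : ∀ a r : ℕ, d = 2 * a → r ≤ m → m + 2 * a ≠ n + 2 * r)
    {x : Skein K m n} (hx : x ∈ skDeg K m n d) : symS K m ⊚ x ⊚ symS K n = 0 := by
  induction hx using Submodule.span_induction with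
  | zero => simp
  | add x y _ _ hx hy => simp [hx, hy]
  | smul c x _ hx => simp [hx]
  | mem x hx =>
    obtain ⟨t, ht, rfl⟩ := hx
    exact (symS_tangle_mem t).comp_symS_eq_zero fun r hr => h _ r ht.symm hr

end Spanning

namespace GrCat

variable {K : Type u} [Field K]

/-! ### Recognition of polynomial algebras -/

/-- The endomorphism algebra of an object of a graded category is polynomial on a generator of
degree two. -/
def HasPolynomialEnd (C : GrCat.{u, v, w} K) (X : C.Obj) : Prop :=
  ∃ (z : C.GrEnd X 2) (φ : K[X] ≃ₐ[K] ⨁ d : ℤ, C.GrEnd X d),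
    φ Polynomial.X = DirectSum.of (C.GrEnd X) 2 z

/-- Powers are formed in the direct sum; comparison in `GradedMonoid` identifies the degree of an
iterated product with `2 * a`. -/
theorem of_pow_eq (C : GrCat.{u, v, w} K) (X : C.Obj) (p : ∀ a : ℕ, C.GrEnd X (2 * a))
    (hp₀ : p 0 = castDeg (by simp) (C.id X))
    (hp : ∀ (a : ℕ) (h : 2 * ((1 : ℕ) : ℤ) + 2 * (a : ℤ) = 2 * ((a + 1 : ℕ) : ℤ)),
      C.comp h (p 1) (p a) = p (a + 1)) (a : ℕ) :
    DirectSum.of (C.GrEnd X) (2 * (1 : ℕ)) (p 1) ^ a = DirectSum.of (C.GrEnd X) (2 * a) (p a) := by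
  induction a with
  | zero =>
    rw [pow_zero, hp₀]
    rfl
  | succ a ih =>
    rw [pow_succ, ih, DirectSum.of_mul_of]
    refine DirectSum.of_eq_of_gradedMonoid_eq (A := C.GrEnd X) ?_
    refine (C.mk_comp _ (k' := 2 * ((a + 1 : ℕ) : ℤ)) (by push_cast; ring) _ _).trans ?_
    exact congrArg (GradedMonoid.mk _) (hp a _)

/-- An endomorphism algebra is polynomial if its homogeneous components are spanned by the powers
of one endomorphism of degree two, all of which are nonzero. -/
theorem exists_polynomial_equiv (C : GrCat.{u, v, w} K) (X : C.Obj) (z : C.GrEnd X 2)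
    (p : ∀ a : ℕ, C.GrEnd X (2 * a))
    (hpow : ∀ a : ℕ, DirectSum.of (C.GrEnd X) 2 z ^ a = DirectSum.of (C.GrEnd X) (2 * a) (p a))
    (hne : ∀ a, p a ≠ 0) (hspan : ∀ (a : ℕ) (f : C.GrEnd X (2 * a)), ∃ c : K, f = c • p a)
    (hzero : ∀ d : ℤ, (∀ a : ℕ, d ≠ 2 * a) → ∀ f : C.GrEnd X d, f = 0) :
    ∃ φ : K[X] ≃ₐ[K] ⨁ d : ℤ, C.GrEnd X d, φ Polynomial.X = DirectSum.of (C.GrEnd X) 2 z := by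
  -- The component of `P(z)` in degree `2 a` sees only the coefficient of index `a`; as `p a ≠ 0`,
  -- this gives injectivity.
  have key : ∀ (P : K[X]) (a : ℕ),
      (aeval (DirectSum.of (C.GrEnd X) 2 z) P) (2 * a) = P.coeff a • p a := fun P a => by
    induction P using Polynomial.induction_on' with
    | add P Q hP hQ => rw [map_add, DirectSum.add_apply, hP, hQ, coeff_add, add_smul]
    | monomial n r =>
      rw [aeval_monomial, ← Algebra.smul_def, hpow, DirectSum.smul_apply, coeff_monomial]
      split_ifs with h
      · subst h
        rw [DirectSum.of_eq_same]
      · rw [DirectSum.of_eq_of_ne _ _ _ (by simpa using Ne.symm h), smul_zero, zero_smul]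
  refine ⟨AlgEquiv.ofBijective (aeval (DirectSum.of (C.GrEnd X) 2 z)) ⟨?_, fun x => ?_⟩, ?_⟩
  · refine (injective_iff_map_eq_zero _).2 fun P hP => Polynomial.ext fun a => ?_
    have := key P a
    rw [hP, DirectSum.zero_apply] at this
    rw [coeff_zero]
    exact (smul_eq_zero.1 this.symm).resolve_right (hne a)
  · induction x using DirectSum.induction_on with
    | zero => exact ⟨0, map_zero _⟩
    | add x y hx hy =>
      obtain ⟨P, rfl⟩ := hx
      obtain ⟨Q, rfl⟩ := hy
      exact ⟨P + Q, map_add _ _ _⟩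
    | of d f =>
      by_cases h : ∃ a : ℕ, d = 2 * a
      · obtain ⟨a, rfl⟩ := h
        obtain ⟨c, rfl⟩ := hspan a f
        refine ⟨monomial a c, ?_⟩
        rw [aeval_monomial, ← Algebra.smul_def, hpow]
        exact ((DirectSum.lof K ℤ (C.GrEnd X) (2 * a)).map_smul c (p a)).symm
      · exact ⟨0, by rw [hzero d (by simpa using h) f, map_zero, map_zero]⟩
  · exact aeval_X _

/-! ### Endomorphisms of ind-objects -/

variable {C : GrCat.{u, v, w} K}

theorem mat_comp_unit {X Y Z : C.Obj} {a b c d e k : ℤ} (h : d + e = k)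
    (h' : d - (b - a) + (e - (c - b)) = k - (c - a))
    (f : C.MatHom ⟨Unit, fun _ => a, fun _ => X⟩ ⟨Unit, fun _ => b, fun _ => Y⟩ d)
    (g : C.MatHom ⟨Unit, fun _ => b, fun _ => Y⟩ ⟨Unit, fun _ => c, fun _ => Z⟩ e) :
    (C.Mat.comp h f g : C.MatHom ⟨Unit, fun _ => a, fun _ => X⟩ ⟨Unit, fun _ => c, fun _ => Z⟩ k)
      () () = C.comp h' (f () ()) (g () ()) :=
  Fintype.sum_unique (ι := Unit) fun _ => C.comp h' (f () ()) (g () ())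

/-- An ind-object, as an object of the ind-completion. -/
def IndObj.toInd (α : C.IndObj) : (Ind C).Obj := α

/-- A morphism into any stage of the diagram can be pushed to a common upper bound of that stage and
its source, where `hspan` applies. So each component of `f` is a multiple of that of `g`, and
compatibility of the families makes the scalars agree. -/
theorem indHom_eq_smul (α : C.IndObj) {d : ℤ} (g : indHom α α d)
    (q : ∀ i, C.Hom (α.at i) (α.at i) d)
    (hg : ∀ i, g.1 i = toColim (α.at i) α d i (q i)) (hne : g ≠ 0)
    (hspan : ∀ {i j} (u : i ⟶ j) (f : C.Hom (α.at i) (α.at j) d),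
      ∃ c : K, f = c • C.comp (add_zero _) (q i) (α.tr u)) (f : indHom α α d) :
    ∃ c : K, f = c • g := by
  have := α.filt
  have hf : ∀ i, ∃ c : K, f.1 i = c • g.1 i := fun i => by
    rw [hg]
    generalize f.1 i = x
    induction x using colim_induction with
    | add x y hx hy =>
      obtain ⟨c, rfl⟩ := hx
      obtain ⟨d, rfl⟩ := hy
      exact ⟨c + d, (add_smul _ _ _).symm⟩
    | of j x =>
      obtain ⟨c, hc⟩ := hspan (IsFiltered.leftToMax i j)
        (C.comp (add_zero _) x (α.tr (IsFiltered.rightToMax i j)))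
      refine ⟨c, ?_⟩
      rw [← toColim_tr (IsFiltered.rightToMax i j) x (add_zero _), hc, map_smul, toColim_tr]
  -- Where a component of `g` vanishes the scalar is not determined. It is fixed at a stage `i₀`
  -- with `g.1 i₀ ≠ 0` and carried to any `i` through an upper bound of both.
  obtain ⟨i₀, h₀⟩ : ∃ i, g.1 i ≠ 0 := by
    by_contra! H
    exact hne (Subtype.ext (funext H))
  obtain ⟨c, hc⟩ := hf i₀
  refine ⟨c, Subtype.ext (funext fun i => ?_)⟩
  change f.1 i = c • g.1 i
  obtain ⟨c', hc'⟩ := hf (IsFiltered.max i₀ i)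
  have e : ∀ {k} (u : k ⟶ IsFiltered.max i₀ i), f.1 k = c' • g.1 k := fun {k} u => by
    rw [← f.2 _ _ u, hc', map_smul, g.2 _ _ u]
  have e₀ := e (IsFiltered.leftToMax i₀ i)
  rw [hc, ← sub_eq_zero, ← sub_smul] at e₀
  rw [e (IsFiltered.rightToMax i₀ i), sub_eq_zero.1 ((smul_eq_zero.1 e₀).resolve_right h₀)]

theorem indHom_eq_zero (α : C.IndObj) {d : ℤ}
    (hzero : ∀ {i j} (_ : i ⟶ j) (f : C.Hom (α.at i) (α.at j) d), f = 0) (f : indHom α α d) :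
    f = 0 := by
  have := α.filt
  refine Subtype.ext (funext fun i => ?_)
  change f.1 i = 0
  generalize f.1 i = x
  induction x using colim_induction with
  | add x y hx hy => rw [hx, hy, add_zero]
  | of j g =>
    rw [← toColim_tr (IsFiltered.rightToMax i j) g (add_zero _),
      hzero (IsFiltered.leftToMax i j) (C.comp (add_zero d) g _), map_zero]

/-- An ind-object whose transition maps and the powers of a natural endomorphism of degree two span
all morphisms of its diagram has a polynomial endomorphism algebra. -/
theorem hasPolynomialEnd_ind (α : C.IndObj)
    (q : ∀ (a : ℕ) (i : α.I), C.Hom (α.at i) (α.at i) (2 * a))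
    (hq₀ : ∀ i, q 0 i = castDeg (by simp) (C.id (α.at i)))
    (hq : ∀ (a : ℕ) i (h : 2 * ((1 : ℕ) : ℤ) + 2 * (a : ℤ) = 2 * ((a + 1 : ℕ) : ℤ)),
      C.comp h (q 1 i) (q a i) = q (a + 1) i)
    (hnat : ∀ (a : ℕ) {i j} (u : i ⟶ j),
      C.comp (zero_add _) (α.tr u) (q a j) = C.comp (add_zero _) (q a i) (α.tr u))
    (hspan : ∀ (a : ℕ) {i j} (u : i ⟶ j) (f : C.Hom (α.at i) (α.at j) (2 * a)),
      ∃ c : K, f = c • C.comp (add_zero _) (q a i) (α.tr u))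
    (hzero : ∀ d : ℤ, (∀ a : ℕ, d ≠ 2 * a) →
      ∀ {i j} (_ : i ⟶ j) (f : C.Hom (α.at i) (α.at j) d), f = 0)
    (hne : ∀ a : ℕ, ∃ i, toColim (α.at i) α (2 * a) i (q a i) ≠ 0) :
    HasPolynomialEnd (Ind C) α.toInd := by
  let p : ∀ a : ℕ, indHom α α (2 * a) := fun a =>
    ⟨fun i => toColim (α.at i) α (2 * a) i (q a i), fun i i' u => by
      rw [preColim_toColim, hnat, toColim_tr]⟩
  have h₀ : p 0 = castDeg (C := Ind C) (by simp) ((Ind C).id α.toInd) := by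
    refine Subtype.ext (funext fun i => ?_)
    exact congrArg (toColim (α.at i) α 0 i) (hq₀ i)
  have h₁ : ∀ (a : ℕ) (h : 2 * ((1 : ℕ) : ℤ) + 2 * (a : ℤ) = 2 * ((a + 1 : ℕ) : ℤ)),
      indComp h (p 1) (p a) = p (a + 1) := fun a h => by
    refine Subtype.ext (funext fun i => ?_)
    change postColim _ h (p a) (toColim _ _ _ _ _) = toColim _ _ _ _ _
    rw [postColim_toColim]
    change preColim _ _ _ (toColim _ _ _ _ _) = _
    rw [preColim_toColim, hq]
  have hne' : ∀ a, p a ≠ 0 := fun a h => by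
    obtain ⟨i, hi⟩ := hne a
    exact hi (congrFun (congrArg Subtype.val h) i)
  exact ⟨p 1, exists_polynomial_equiv (Ind C) α.toInd (p 1) p (of_pow_eq (Ind C) α.toInd p h₀ h₁) hne'
    (fun a f => indHom_eq_smul α (p a) (q a) (fun _ => rfl) (hne' a) (hspan a) f)
    (fun d hd f => indHom_eq_zero α (hzero d hd) f)⟩

end GrCat

section KirbyEnd

variable (K : Type u) [Field K]

local infixl:70 " ⊚ " => skComp _

/-! ### The action on symmetric covectors -/

variable {K} in
theorem skAct_cupS {n i : ℕ} (h : i ≤ n) : skAct (cupS K n i) = cupAct K i := by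
  rw [cupS, dif_pos h, skAct_cls, linAct_cupL]

variable {K} in
theorem skAct_capS {n i : ℕ} (h : i ≤ n) : skAct (capS K n i) = capAct K i := by
  rw [capS, dif_pos h, skAct_cls, linAct_capL]

variable {K} in
theorem skAct_dotS {n i : ℕ} (h : i < n) : skAct (dotS K n i) = dotAct K i := by
  rw [dotS, dif_pos h, skAct_cls, linAct_dotL]

variable {K} in
theorem skAct_idS (n : ℕ) : skAct (idS K n) = 1 := by
  rw [idS, skAct_cls, linAct_idL]

variable {K} in
theorem skAct_dcupS (g : ℕ → K) (n : ℕ) :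
    skAct (dcupS K n) (symCov g (n + 2)) = symCov g n := by
  rw [dcupS, skAct_skComp, skAct_cupS le_rfl, skAct_dotS (by omega), Module.End.mul_apply,
    cupAct_dotAct_symCov]

variable {K} in
theorem skAct_altDot (g : ℕ → K) (n : ℕ) :
    skAct (altDot K n) (symCov g n) = symCov (fun k => k * g (k - 1)) n := by
  rw [altDot, map_sum, LinearMap.sum_apply, ← sum_dotAct_symCov]
  refine Finset.sum_congr rfl fun i hi => ?_
  rw [map_smul, LinearMap.smul_apply, skAct_dotS (Finset.mem_range.1 hi)]

/-- The contravariant action of degree zero endomorphisms on covectors. -/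
def endAct (n : ℕ) : (dTL K).End₀ (gen K n) →ₗ[K] Module.End K ((ℕ → Bool) → K) :=
  skAct ∘ₗ (skDeg K n n 0).subtype

variable {K}

theorem endAct_mul {n : ℕ} (x y : (dTL K).End₀ (gen K n)) :
    endAct K n (x * y) = endAct K n y * endAct K n x :=
  skAct_skComp (K := K) (show skDeg K n n 0 from y).1 (show skDeg K n n 0 from x).1

theorem endAct_one (n : ℕ) : endAct K n 1 = 1 := skAct_idS n

/-- A crossing is the identity minus a turnback, and pulling back along the cup of the turnback
already kills a symmetric covector. -/
theorem endAct_crossing (g : ℕ → K) (n i : ℕ) :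
    endAct K n (crossing K n i) (symCov g n) = symCov g n := by
  match n with
  | 0 => rw [crossing, endAct_one]; rfl
  | 1 => rw [crossing, endAct_one]; rfl
  | n + 2 =>
    rw [crossing]
    split_ifs with h
    · have e : endAct K (n + 2) (tb K n i h) = capAct K i * cupAct K i := by
        rw [← skAct_cupS h, ← skAct_capS h, cupS, capS, dif_pos h, dif_pos h, ← skAct_skComp]
        rfl
      rw [map_sub, endAct_one, e, LinearMap.sub_apply, Module.End.mul_apply, cupAct_symCov g h,
        map_zero, sub_zero]
      rfl
    · rw [endAct_one]; rfl

theorem endAct_permAct (g : ℕ → K) (n : ℕ) (w : Equiv.Perm (Fin n)) :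
    endAct K n (permAct K n w) (symCov g n) = symCov g n := by
  have hw : w ∈ Submonoid.closure {w | ∃ i, i + 1 < n ∧ w = Coxeter.adj n i} := by
    rw [Coxeter.closure_adj]; trivial
  induction hw using Submonoid.closure_induction with
  | mem _ h =>
    obtain ⟨i, hi, rfl⟩ := h
    rw [permAct, (coxeter_crossing K n).lift_adj i hi, endAct_crossing]
  | one => rw [map_one, endAct_one]; rfl
  | mul x y _ _ hx hy => rw [map_mul, endAct_mul, Module.End.mul_apply, hx, hy]

theorem skAct_symS [CharZero K] (g : ℕ → K) (n : ℕ) :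
    skAct (symS K n) (symCov g n) = symCov g n := by
  change endAct K n (symm K n) (symCov g n) = symCov g n
  rw [symm, map_smul, map_sum, LinearMap.smul_apply, LinearMap.sum_apply,
    Finset.sum_congr rfl fun w _ => endAct_permAct g n w, Finset.sum_const, Finset.card_univ,
    Fintype.card_perm, Fintype.card_fin, ← Nat.cast_smul_eq_nsmul K, smul_smul,
    inv_mul_cancel₀ (by exact_mod_cast n.factorial_ne_zero), one_smul]

variable (K) in
/-- The powers of the alternating sum of the dots. -/
def altPow (n : ℕ) : ℕ → Skein K n n
  | 0 => idS K n
  | a + 1 => altDot K n ⊚ altPow n a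

theorem altPow_central {m n : ℕ} (x : Skein K m n) (a : ℕ) :
    x ⊚ altPow K n a = altPow K m a ⊚ x := by
  induction a with
  | zero => rw [altPow, altPow, comp_idS, idS_comp]
  | succ a ih => rw [altPow, altPow, ← skComp_assoc, altDot_central, skComp_assoc, ih, skComp_assoc]

theorem altDot_mem (n : ℕ) : altDot K n ∈ skDeg K n n 2 :=
  Submodule.sum_mem _ fun i hi => Submodule.smul_mem _ _ (by
    rw [dotS, dif_pos (Finset.mem_range.1 hi)]
    exact dotL_mem n i _)

theorem altPow_mem (n a : ℕ) : altPow K n a ∈ skDeg K n n (2 * a) := by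
  induction a with
  | zero => exact idL_mem n
  | succ a ih => exact skComp_mem (by push_cast; ring) (altDot_mem n) ih

/-- Iterating `g(k) ↦ k g(k - 1)` from the constant `1` produces falling factorials. -/
theorem skAct_altPow (n a : ℕ) : skAct (altPow K n a) (symCov (fun _ => 1) n) =
    symCov (fun k => (k.descFactorial a : K)) n := by
  induction a with
  | zero => rw [altPow, skAct_idS]; simp
  | succ a ih =>
    rw [altPow, skAct_skComp, Module.End.mul_apply, ih, skAct_altDot]
    congr 1
    ext k
    cases k with
    | zero => simp
    | succ k => rw [Nat.succ_descFactorial_succ]; push_cast; rfl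

/-! ### Morphisms between shifted symmetric powers -/

variable [CharZero K]

variable (K) in
/-- The shifted symmetric power, as an object of the additive completion. -/
def shiftSymObj (n : ℕ) : (dTL K).Kar.Mat.Obj := shiftSym K n

/-- The class of tangles that underlies a morphism of symmetric powers. -/
def karVal {m n : ℕ} {d : ℤ} (f : (dTL K).karHom (symObj K m) (symObj K n) d) : skDeg K m n d := f.1

/-- The entry of a one-by-one matrix. -/
def matEntry {m n : ℕ} {d : ℤ} (f : (dTL K).Kar.Mat.Hom (shiftSymObj K m) (shiftSymObj K n) d) :
    (dTL K).karHom (symObj K m) (symObj K n) (d - (-(n : ℤ) - -(m : ℤ))) :=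
  (show (dTL K).Kar.MatHom (shiftSym K m) (shiftSym K n) d from f) () ()

/-- The class of tangles that underlies a morphism of shifted symmetric powers. -/
def skeinOf {m n : ℕ} {d : ℤ} :
    (dTL K).Kar.Mat.Hom (shiftSymObj K m) (shiftSymObj K n) d →ₗ[K] Skein K m n where
  toFun f := (karVal (matEntry f)).1
  map_add' _ _ := rfl
  map_smul' _ _ := rfl

theorem skeinOf_injective {m n : ℕ} {d : ℤ} {f g : (dTL K).Kar.Mat.Hom (shiftSymObj K m)
    (shiftSymObj K n) d} (h : skeinOf f = skeinOf g) : f = g := by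
  have : matEntry f = matEntry g := Subtype.ext (Subtype.ext h)
  exact funext fun _ => funext fun _ => this

/-- The shifts `q^(-m)` and `q^(-n)` make a morphism of degree `d` come from tangles of degree `d +
n - m`. -/
theorem skeinOf_mem {m n : ℕ} {d e : ℤ} (h : d + n - m = e)
    (f : (dTL K).Kar.Mat.Hom (shiftSymObj K m) (shiftSymObj K n) d) :
    skeinOf f ∈ skDeg K m n e := by
  have : skeinOf f ∈ skDeg K m n (d - (-(n : ℤ) - -(m : ℤ))) := (karVal (matEntry f)).2
  rwa [show d - (-(n : ℤ) - -(m : ℤ)) = e by rw [← h]; ring] at this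

theorem symS_skeinOf_symS {m n : ℕ} {d : ℤ}
    (f : (dTL K).Kar.Mat.Hom (shiftSymObj K m) (shiftSymObj K n) d) :
    symS K m ⊚ skeinOf f ⊚ symS K n = skeinOf f :=
  (congrArg Subtype.val (show karVal (matEntry f) = _ from (matEntry f).2)).symm

theorem skeinOf_comp {l m n : ℕ} {d e k : ℤ} (h : d + e = k)
    (f : (dTL K).Kar.Mat.Hom (shiftSymObj K l) (shiftSymObj K m) d)
    (g : (dTL K).Kar.Mat.Hom (shiftSymObj K m) (shiftSymObj K n) e) :
    skeinOf ((dTL K).Kar.Mat.comp h f g) = skeinOf f ⊚ skeinOf g := by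
  have e : matEntry ((dTL K).Kar.Mat.comp h f g) =
      (dTL K).Kar.comp (by rw [← h]; ring) (matEntry f) (matEntry g) := by
    exact GrCat.mat_comp_unit (C := (dTL K).Kar) h _ f g
  exact congrArg (fun x => (karVal x).1) e

theorem skeinOf_id (n : ℕ) : skeinOf ((dTL K).Kar.Mat.id (shiftSymObj K n)) = symS K n := by
  have e : ∀ {d : ℤ} (hd : d = 0),
      (karVal ((dTL K).Kar.idAt (X := symObj K n) rfl hd)).1 = symS K n := by
    rintro _ rfl
    rfl
  have e' : matEntry ((dTL K).Kar.Mat.id (shiftSymObj K n)) =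
      (dTL K).Kar.idAt (X := symObj K n) rfl (by ring) := dif_pos rfl
  exact (congrArg (fun x => (karVal x).1) e').trans (e _)

/-- The morphism of shifted symmetric powers induced by a class of tangles. -/
def symHom {m n : ℕ} {d e : ℤ} (h : d + n - m = e) (x : Skein K m n) (hx : x ∈ skDeg K m n e) :
    (dTL K).Kar.Mat.Hom (shiftSymObj K m) (shiftSymObj K n) d := fun _ _ =>
  GrCat.karProj (C := dTL K) (symObj K m) (symObj K n)
    (⟨x, by rwa [show d - (-(n : ℤ) - -(m : ℤ)) = e by rw [← h]; ring]⟩ :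
      skDeg K m n (d - (-(n : ℤ) - -(m : ℤ))))

theorem skeinOf_symHom {m n : ℕ} {d e : ℤ} (h : d + n - m = e) (x : Skein K m n)
    (hx : x ∈ skDeg K m n e) :
    skeinOf (symHom (K := K) h x hx) = symS K m ⊚ x ⊚ symS K n := rfl

variable (K) in
/-- The dotted cup between shifted symmetric powers. -/
def shiftCupHom (n : ℕ) : (dTL K).Kar.Mat.Hom (shiftSymObj K n) (shiftSymObj K (n + 2)) 0 :=
  shiftCup K n

theorem skeinOf_shiftCupHom (n : ℕ) :
    skeinOf (shiftCupHom K n) = symS K n ⊚ dcupS K n ⊚ symS K (n + 2) := by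
  have e : ∀ {d : ℤ} (h : 2 = d),
      (karVal (GrCat.castDeg (C := (dTL K).Kar) h (symCup K n))).1 = (karVal (symCup K n)).1 := by
    rintro _ rfl
    rfl
  refine (e _).trans ?_
  rw [dcupS, cupS, dotS, dif_pos le_rfl, dif_pos (by omega)]
  rfl

/-! ### The endomorphisms of the Kirby objects -/

variable (K) in
/-- The Kirby object of nonnegative winding number, as a directed system. -/
def kirbyInd (k : ℕ) : (dTL K).Kar.Mat.IndObj := { I := ℕ, F := kirbySystem K k }

variable (K) in
/-- The transition morphisms of a Kirby object. -/
def kirbyTr (k : ℕ) {i j : ℕ} (u : i ⟶ j) :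
    (dTL K).Kar.Mat.Hom (shiftSymObj K (k + 2 * i)) (shiftSymObj K (k + 2 * j)) 0 :=
  (kirbyInd K k).tr (i := i) (j := j) u

theorem kirbyTr_id (k i : ℕ) : kirbyTr K k (𝟙 i) = (dTL K).Kar.Mat.id (shiftSymObj K (k + 2 * i)) :=
  (kirbyInd K k).tr_id i

theorem kirbyTr_comp (k : ℕ) {i j l : ℕ} (u : i ⟶ j) (v : j ⟶ l) : kirbyTr K k (u ≫ v) =
    (dTL K).Kar.Mat.comp (add_zero 0) (kirbyTr K k u) (kirbyTr K k v) :=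
  (kirbyInd K k).tr_comp u v

theorem kirbyTr_succ (k i : ℕ) :
    kirbyTr K k (homOfLE (Nat.le_add_right i 1)) = shiftCupHom K (k + 2 * i) :=
  Functor.ofSequence_map_homOfLE_succ (C := (dTL K).Kar.Mat.Zero)
    (X := fun n => shiftSym K (k + 2 * n)) (fun n => shiftCup K (k + 2 * n)) i

/-- Each step of the system is a dotted cup between two symmetrizers, and all three pull the
covector of `g` back to the covector of `g`. -/
theorem skAct_kirbyTr (g : ℕ → K) (k : ℕ) {i j : ℕ} (u : i ⟶ j) :
    skAct (skeinOf (kirbyTr K k u)) (symCov g (k + 2 * j)) = symCov g (k + 2 * i) := by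
  obtain ⟨l, rfl⟩ := Nat.exists_eq_add_of_le (leOfHom u)
  induction l with
  | zero =>
    rw [show u = 𝟙 i from Subsingleton.elim _ _, kirbyTr_id, skeinOf_id]
    exact skAct_symS g _
  | succ l ih =>
    rw [show u = homOfLE (Nat.le_add_right i l) ≫ homOfLE (Nat.le_add_right (i + l) 1) from
      Subsingleton.elim _ _, kirbyTr_comp, skeinOf_comp, skAct_skComp, Module.End.mul_apply,
      kirbyTr_succ, skeinOf_shiftCupHom, skAct_skComp, skAct_skComp, Module.End.mul_apply,
      Module.End.mul_apply]
    refine (congrArg _ ?_).trans (ih _)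
    exact (congrArg (fun ψ => skAct (symS K _) (skAct (dcupS K _) ψ)) (skAct_symS g _)).trans
      ((congrArg _ (skAct_dcupS g _)).trans (skAct_symS g _))

variable (K) in
/-- The powers of the central endomorphism of degree two of a shifted symmetric power. -/
def altHom (n a : ℕ) : (dTL K).Kar.Mat.Hom (shiftSymObj K n) (shiftSymObj K n) (2 * a) :=
  symHom (by ring) (altPow K n a) (altPow_mem n a)

theorem skeinOf_altHom (n a : ℕ) : skeinOf (altHom K n a) = altPow K n a ⊚ symS K n := by
  rw [altHom, skeinOf_symHom, altPow_central, skComp_assoc, symS_symS]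

theorem symS_skeinOf {m n : ℕ} {d : ℤ}
    (f : (dTL K).Kar.Mat.Hom (shiftSymObj K m) (shiftSymObj K n) d) :
    symS K m ⊚ skeinOf f = skeinOf f := by
  rw [← symS_skeinOf_symS f, ← skComp_assoc, ← skComp_assoc, symS_symS]

theorem skeinOf_symS {m n : ℕ} {d : ℤ}
    (f : (dTL K).Kar.Mat.Hom (shiftSymObj K m) (shiftSymObj K n) d) :
    skeinOf f ⊚ symS K n = skeinOf f := by
  rw [← symS_skeinOf_symS f, skComp_assoc, symS_symS]

theorem altHom_zero (n : ℕ) :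
    altHom K n 0 = GrCat.castDeg (by simp) ((dTL K).Kar.Mat.id (shiftSymObj K n)) := by
  refine skeinOf_injective ?_
  rw [skeinOf_altHom, altPow, idS_comp]
  exact (skeinOf_id n).symm

theorem altHom_succ (n a : ℕ) (h : 2 * ((1 : ℕ) : ℤ) + 2 * (a : ℤ) = 2 * ((a + 1 : ℕ) : ℤ)) :
    (dTL K).Kar.Mat.comp h (altHom K n 1) (altHom K n a) = altHom K n (a + 1) := by
  refine skeinOf_injective ?_
  rw [skeinOf_comp, skeinOf_altHom, skComp_assoc, symS_skeinOf, skeinOf_altHom, skeinOf_altHom,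
    altPow, altPow, altPow, comp_idS, skComp_assoc]

theorem altHom_natural (a : ℕ) {m n : ℕ}
    (f : (dTL K).Kar.Mat.Hom (shiftSymObj K m) (shiftSymObj K n) 0) :
    (dTL K).Kar.Mat.comp (zero_add _) f (altHom K n a) =
      (dTL K).Kar.Mat.comp (add_zero _) (altHom K m a) f := by
  refine skeinOf_injective ?_
  rw [skeinOf_comp, skeinOf_comp, skeinOf_altHom, skeinOf_altHom, ← skComp_assoc, altPow_central,
    skComp_assoc, skeinOf_symS, skComp_assoc, symS_skeinOf]

theorem skAct_altHom (n a : ℕ) : skAct (skeinOf (altHom K n a)) (symCov (fun _ => 1) n) =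
    symCov (fun k => (k.descFactorial a : K)) n := by
  rw [skeinOf_altHom, skAct_skComp, Module.End.mul_apply, skAct_symS, skAct_altPow]

/-- Both morphisms are multiples of the same normal form, so it suffices that the second one be
nonzero when the space is; its action on the constant covector detects this. -/
theorem eq_smul_altHom_comp_kirbyTr (k a : ℕ) {i j : ℕ} (u : i ⟶ j)
    (f : (dTL K).Kar.Mat.Hom (shiftSymObj K (k + 2 * i)) (shiftSymObj K (k + 2 * j)) (2 * a)) :
    ∃ c : K, f = c • (dTL K).Kar.Mat.comp (add_zero _) (altHom K (k + 2 * i) a)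
      (kirbyTr K k u) := by
  have hij := leOfHom u
  -- The shifts contribute `j - i` extra dots, and `(k + 2 i) + 2 (a + (j - i)) = (k + 2 j) + 2 a`
  -- forces exactly `a` nested caps.
  have key : ∀ f : (dTL K).Kar.Mat.Hom (shiftSymObj K (k + 2 * i)) (shiftSymObj K (k + 2 * j))
      (2 * a), ∃ c : K, skeinOf f =
        c • (symCupCaps K (k + 2 * i) (a + (j - i)) a (k + 2 * j) ⊚
          symS K (k + 2 * j)) := fun f => by
    rw [← symS_skeinOf_symS f]
    refine symS_comp_symS_eq_smul (by omega) (skeinOf_mem ?_ f)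
    push_cast [Nat.cast_sub hij]
    ring
  -- With fewer than `a` strands at the bottom there is no room for `a` nested caps, and the whole
  -- space is zero.
  rcases Nat.lt_or_ge (k + 2 * i) a with ha | ha
  · refine ⟨0, skeinOf_injective ?_⟩
    obtain ⟨c, hc⟩ := key f
    rw [hc, symCupCaps_eq_zero (Or.inr ha), zero_smul]
    simp
  · obtain ⟨c, hc⟩ := key f
    obtain ⟨d, hd⟩ := key ((dTL K).Kar.Mat.comp (add_zero _) (altHom K (k + 2 * i) a)
      (kirbyTr K k u))
    -- Evaluation at the all-`true` word gives the falling factorial of `k + 2 i` of length `a`,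
    -- which is nonzero because `a ≤ k + 2 i`.
    have hd₀ : d ≠ 0 := by
      rintro rfl
      rw [zero_smul, skeinOf_comp] at hd
      have := congrArg (fun x => skAct x (symCov (fun _ => (1 : K)) (k + 2 * j)) fun _ => true) hd
      simp only [skAct_skComp, Module.End.mul_apply, skAct_kirbyTr, skAct_altHom, symCov_top,
        map_zero, LinearMap.zero_apply, Pi.zero_apply, Nat.cast_eq_zero,
        Nat.descFactorial_eq_zero_iff_lt] at this
      omega
    refine ⟨c / d, skeinOf_injective ?_⟩
    rw [map_smul, hd, hc, smul_smul, div_mul_cancel₀ c hd₀]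

/-- A normal form with `r` nested caps has shifted degree `2 r`, so negative even degrees are
excluded along with the odd ones. -/
theorem eq_zero_of_odd (k : ℕ) {d : ℤ} (hd : ∀ a : ℕ, d ≠ 2 * a) {i j : ℕ} (_ : i ≤ j)
    (f : (dTL K).Kar.Mat.Hom (shiftSymObj K (k + 2 * i)) (shiftSymObj K (k + 2 * j)) d) :
    f = 0 := by
  refine skeinOf_injective ?_
  rw [← symS_skeinOf_symS f, map_zero]
  refine symS_comp_symS_eq_zero (fun a r ha _ h => hd r ?_) (skeinOf_mem rfl f)
  push_cast at ha
  omega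

/-- Pullback of the constant covector followed by evaluation at the all-`true` word is invariant
under the transition maps, hence descends to the colimit, where it takes a nonzero falling factorial
as its value on this class. -/
theorem toColim_altHom_ne_zero (k i a : ℕ) (h : a ≤ k + 2 * i) :
    GrCat.toColim (C := (dTL K).Kar.Mat) (shiftSymObj K (k + 2 * i)) (kirbyInd K k) (2 * a) i
      (altHom K (k + 2 * i) a) ≠ 0 := by
  let φ : ∀ j : ℕ, (dTL K).Kar.Mat.Hom (shiftSymObj K (k + 2 * i)) (shiftSymObj K (k + 2 * j))
      (2 * a) →ₗ[K] K := fun j =>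
    LinearMap.proj (fun _ => true) ∘ₗ LinearMap.applyₗ (symCov (fun _ => (1 : K)) (k + 2 * j)) ∘ₗ
      skAct ∘ₗ skeinOf
  have hφ : ∀ (j j' : ℕ) (u : j ⟶ j') f,
      φ j' ((dTL K).Kar.Mat.comp (add_zero _) f (kirbyTr K k u)) = φ j f := fun j j' u f => by
    change skAct (skeinOf _) _ _ = skAct (skeinOf _) _ _
    rw [skeinOf_comp, skAct_skComp, Module.End.mul_apply, skAct_kirbyTr]
  intro H
  have := (GrCat.colimDesc_toColim (C := (dTL K).Kar.Mat) (X := shiftSymObj K (k + 2 * i))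
    (β := kirbyInd K k) φ hφ i (altHom K (k + 2 * i) a)).symm.trans
    ((congrArg _ H).trans (map_zero _))
  change skAct (skeinOf _) _ _ = 0 at this
  rw [skAct_altHom, symCov_top, Nat.cast_eq_zero, Nat.descFactorial_eq_zero_iff_lt] at this
  omega

theorem hasPolynomialEnd_kirbyInd (k : ℕ) :
    GrCat.HasPolynomialEnd (dTL K).Kar.Mat.Ind (kirbyInd K k).toInd :=
  GrCat.hasPolynomialEnd_ind (kirbyInd K k) (fun a (i : ℕ) => altHom K (k + 2 * i) a)
    (fun (i : ℕ) => altHom_zero (k + 2 * i))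
    (fun a (i : ℕ) h => altHom_succ (k + 2 * i) a h)
    (fun a {i j} u => altHom_natural a (kirbyTr K k (i := i) (j := j) u))
    (fun a {i j} u f => eq_smul_altHom_comp_kirbyTr k a (i := i) (j := j) u f)
    (fun d hd {i j} u f => eq_zero_of_odd k hd (i := i) (j := j) (leOfHom u) f)
    -- Any stage with at least `a` strands would do; stage `a` has `k + 2 a`.
    (fun a => ⟨a, toColim_altHom_ne_zero k a a (by omega)⟩)

theorem hasPolynomialEnd_kirby (i : ℤ) : GrCat.HasPolynomialEnd (dTLbar K) (kirby K i) :=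
  hasPolynomialEnd_kirbyInd i.natAbs

end KirbyEnd

end

end KirbyColor

/-- For every integer `i`, the graded endomorphism algebra of the Kirby object of winding number `i`
is a polynomial algebra on a generator of degree two: there is an algebra isomorphism from `K[X]`
that sends `X` to a homogeneous element `z` of degree two (hence `X ^ n` to degree `2 * n`). -/
theorem mainTheorem10 (K : Type u) [Field K] [CharZero K] (i : ℤ) :
    ∃ (z : (KirbyColor.dTLbar K).GrEnd (KirbyColor.kirby K i) 2)
      (φ : K[X] ≃ₐ[K] ⨁ d : ℤ, (KirbyColor.dTLbar K).GrEnd (KirbyColor.kirby K i) d),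
      φ X = DirectSum.of ((KirbyColor.dTLbar K).GrEnd (KirbyColor.kirby K i)) 2 z :=
  KirbyColor.hasPolynomialEnd_kirby i
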